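/- Let $k\ge 1$, let $\mathbf n=(n_1,\dots,n_k)$ and $\mathbf m=(m_1,\dots,m_k)$ be $k$-tuples of positive integers, let $\mathcal K$ be a complex Hilbert space and let $\mathcal H$ be a separable infinite-dimensional complex Hilbert space. For $\mathbf X=(X_1,\dots,X_k)$ with $X_i=(X_{i,1},\dots,X_{i,n_i})\in B(\mathcal H)^{n_i}$ put $\Phi_{X_i}(Y)=\sum_{j=1}^{n_i}X_{i,j}YX_{i,j}^*$ and, for $\mathbf p\in\mathbb Z_{\ge 0}^k$, $\boldsymbol\Delta^{\mathbf p}_{\mathbf X}=(\mathrm{id}-\Phi_{X_1})^{p_1}\circ\cdots\circ(\mathrm{id}-\Phi_{X_k})^{p_k}$. The poly-hyperball $\mathbf D^{\mathbf m}_{\mathbf n}(\mathcal H)$ is the set of all such $\mathbf X$ for which the entries of $X_p$ commute with the entries of $X_q$ whenever $p\ne q$, and $\boldsymbol\Delta^{\mathbf p}_{\mathbf X}(I)\ge 0$ for all $0\le\mathbf p\le\mathbf m$. Its radial part is $\mathbf D^{\mathbf m}_{\mathbf n,rad}(\mathcal H)=\bigcup_{0\le r<1}r\,\mathbf D^{\mathbf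 m}_{\mathbf n}(\mathcal H)$. An element $\mathbf X\in\mathbf D^{\mathbf m}_{\mathbf n}(\mathcal H)$ is called pure if, for every $i$, $\Phi_{X_i}^p(I)\to 0$ strongly as $p\to\infty$. Let $\mathbb F_{n_i}^+$ be the free monoid on $n_i$ generators, $|\alpha|$ the length of a word $\alpha$, and, for $\alpha=g_{j_1}\cdots g_{j_p}\in\mathbb F_{n_i}^+$, $X_{i,\alpha}=X_{i,j_1}\cdots X_{i,j_p}$. A function $F:\mathbf D^{\mathbf m}_{\mathbf n,rad}(\mathcal H)\to B(\mathcal K)\otimes_{min}B(\mathcal H)\subset B(\mathcal K\otimes\mathcal H)$ is a free $k$-pluriharmonic function with coefficients in $B(\mathcal K)$ if there are operators $A_{(\alpha_1,\dots,\alpha_k,\beta_1,\dots,\beta_k)}\in B(\mathcal K)$ such that $$F(\mathbf X)=\sum_{s_1\in\mathbb Z}\cdots\sum_{s_k\in\mathbb Z}\ \sum_{\substack{\alpha_i,\beta_i\in\mathbb F_{n_i}^+\\ |\alpha_i|=s_i^+,\ |\beta_i|=s_i^-}}A_{(\alpha_1,\dots,\alpha_k,\beta_1,\dots,\beta_k)}\otimes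 X_{1,\alpha_1}\cdots X_{k,\alpha_k}X_{1,\beta_1}^*\cdots X_{k,\beta_k}^*$$ for every $\mathbf X\in\mathbf D^{\mathbf m}_{\mathbf n,rad}(\mathcal H)$, where $s^+=\max(s,0)$, $s^-=\max(-s,0)$, the series is an iterated one, each sum over $\mathbb Z$ being the limit in the operator norm of its partial sums over $|s_i|\le N$. It is bounded if $\sup\{\|F(\mathbf X)\|:\mathbf X\in\mathbf D^{\mathbf m}_{\mathbf n,rad}(\mathcal H)\}<\infty$. If $F:\mathbf D^{\mathbf m}_{\mathbf n,rad}(\mathcal H)\to B(\mathcal K)\otimes_{min}B(\mathcal H)$ is a bounded free $k$-pluriharmonic function and $\mathbf X$ is a pure element of $\mathbf D^{\mathbf m}_{\mathbf n}(\mathcal H)$, then the limit $\mathrm{SOT}\text{-}\lim_{r\to 1^-}F(r\mathbf X)$ exists in $B(\mathcal K\otimes\mathcal H)$. -/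

import Mathlib

open Filter Topology
open scoped TensorProduct

noncomputable section

namespace PolyHyperball

/-! ### Hilbert tensor products -/

/-- The Hilbert tensor product `K ⊗ H`: the completion of the algebraic tensor product with
respect to `⟪x ⊗ y, x' ⊗ y'⟫ = ⟪x, x'⟫ ⟪y, y'⟫`. -/
abbrev HilbertTensor (K H : Type*) [NormedAddCommGroup K] [InnerProductSpace ℂ K]
    [NormedAddCommGroup H] [InnerProductSpace ℂ H] : Type _ :=
  UniformSpace.Completion (K ⊗[ℂ] H)

/-- The bounded operator `A ⊗ B` on `K ⊗ H`. -/
def opTensor {K H : Type*} [NormedAddCommGroup K] [InnerProductSpace ℂ K]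
    [NormedAddCommGroup H] [InnerProductSpace ℂ H] (A : K →L[ℂ] K) (B : H →L[ℂ] H) :
    HilbertTensor K H →L[ℂ] HilbertTensor K H :=
  (TensorProduct.mapL A B).completion

theorem opTensor_tmul {K H : Type*} [NormedAddCommGroup K] [InnerProductSpace ℂ K]
    [NormedAddCommGroup H] [InnerProductSpace ℂ H] (A : K →L[ℂ] K) (B : H →L[ℂ] H)
    (x : K) (y : H) :
    opTensor A B ((x ⊗ₜ[ℂ] y : K ⊗[ℂ] H) : HilbertTensor K H)
      = ((A x ⊗ₜ[ℂ] B y : K ⊗[ℂ] H) : HilbertTensor K H) := by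
  simp [opTensor]

/-! ### The noncommutative poly-hyperball -/

section Domain

variable {k : ℕ} {H : Type*} [NormedAddCommGroup H] [InnerProductSpace ℂ H] [CompleteSpace H]

/-- The tuples `(X₁, …, X_k)` with `X_i = (X_{i,1}, …, X_{i,n_i})` a tuple of bounded operators
on `H`. -/
abbrev OpTuple {k : ℕ} (n : Fin k → ℕ) (H : Type*) [NormedAddCommGroup H]
    [InnerProductSpace ℂ H] : Type _ :=
  (i : Fin k) → Fin (n i) → (H →L[ℂ] H)

/-- The completely positive map `Φ_Z(Y) = ∑_j Z_j Y Z_j^*` on `B(H)` of a tuple `Z`. -/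
def cpMap {d : ℕ} (Z : Fin d → (H →L[ℂ] H)) : Module.End ℂ (H →L[ℂ] H) where
  toFun Y := ∑ j, Z j * Y * star (Z j)
  map_add' Y Y' := by simp [mul_add, add_mul, Finset.sum_add_distrib]
  map_smul' c Y := by simp [Finset.smul_sum]

/-- The defect mapping `Δ_X^p = (id - Φ_{X₁})^{p₁} ∘ ⋯ ∘ (id - Φ_{X_k})^{p_k}` on `B(H)`; the
product in `Module.End` is composition. -/
def defectMap {n : Fin k → ℕ} (p : Fin k → ℕ) (X : OpTuple n H) : Module.End ℂ (H →L[ℂ] H) :=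
  (List.ofFn fun i => (1 - cpMap (X i)) ^ p i).prod

/-- The poly-hyperball `D_n^m(H)`: the entries of `X_p` commute with the entries of `X_q` for
`p ≠ q`, and `Δ_X^p(I) ≥ 0` for all `0 ≤ p ≤ m`. -/
def polyHyperball (n m : Fin k → ℕ) (H : Type*) [NormedAddCommGroup H] [InnerProductSpace ℂ H]
    [CompleteSpace H] : Set (OpTuple n H) :=
  {X | (∀ i j : Fin k, i ≠ j → ∀ (a : Fin (n i)) (b : Fin (n j)), Commute (X i a) (X j b)) ∧
    ∀ p : Fin k → ℕ, p ≤ m → (defectMap p X 1).IsPositive}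

/-- The radial part `⋃_{0 ≤ r < 1} r D_n^m(H)` of the poly-hyperball. -/
def radialPolyHyperball (n m : Fin k → ℕ) (H : Type*) [NormedAddCommGroup H]
    [InnerProductSpace ℂ H] [CompleteSpace H] : Set (OpTuple n H) :=
  {Y | ∃ r : ℝ, 0 ≤ r ∧ r < 1 ∧ ∃ X ∈ polyHyperball n m H, Y = (r : ℂ) • X}

/-- `X` is pure: for each `i`, `Φ_{X_i}^p(I) → 0` strongly as `p → ∞`. -/
def IsPure {n : Fin k → ℕ} (X : OpTuple n H) : Prop :=
  ∀ i : Fin k, ∀ h : H, Tendsto (fun p : ℕ => ((cpMap (X i)) ^ p) 1 h) atTop (𝓝 0)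

end Domain

/-! ### Free `k`-pluriharmonic functions -/

/-- The words of length `p` in the free monoid on `d` generators. -/
def wordsOfLength (d p : ℕ) : Finset (FreeMonoid (Fin d)) :=
  (Finset.univ : Finset (Fin p → Fin d)).map
    ⟨fun w => FreeMonoid.ofList (List.ofFn w), fun _ _ h =>
      List.ofFn_injective (FreeMonoid.ofList.injective h)⟩

theorem mem_wordsOfLength {d p : ℕ} (α : FreeMonoid (Fin d)) :
    α ∈ wordsOfLength d p ↔ α.length = p := by
  constructor
  · intro h
    obtain ⟨w, -, rfl⟩ := Finset.mem_map.1 h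
    exact List.length_ofFn
  · rintro rfl
    exact Finset.mem_map.2 ⟨fun i => (FreeMonoid.toList α).get i, Finset.mem_univ _,
      congrArg FreeMonoid.ofList (List.ofFn_get (FreeMonoid.toList α))⟩

/-- The iterated series `a = ∑_{s₁ ∈ ℤ} ⋯ ∑_{s_k ∈ ℤ} f(s₁, …, s_k)`, where each series over `ℤ`
is the limit of its partial sums over `|s| ≤ N`. -/
def IteratedHasSum {E : Type*} [AddCommGroup E] [TopologicalSpace E] :
    {k : ℕ} → ((Fin k → ℤ) → E) → E → Prop
  | 0, f, a => f Fin.elim0 = a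
  | k + 1, f, a => ∃ g : ℤ → E,
      (∀ s : ℤ, IteratedHasSum (fun t : Fin k → ℤ => f (Fin.cons s t)) (g s)) ∧
      Tendsto (fun N : ℕ => ∑ s ∈ Finset.Icc (-(N : ℤ)) N, g s) atTop (𝓝 a)

section Pluriharmonic

variable {k : ℕ} {n : Fin k → ℕ}
  {K : Type*} [NormedAddCommGroup K] [InnerProductSpace ℂ K]
  {H : Type*} [NormedAddCommGroup H] [InnerProductSpace ℂ H] [CompleteSpace H]

/-- `X_α = X_{1,α₁} ⋯ X_{k,α_k}`, where `X_{i,α_i}` is the product of the entries of `X_i` along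
the word `α_i`. -/
def wordProd (X : OpTuple n H) (α : (i : Fin k) → FreeMonoid (Fin (n i))) : H →L[ℂ] H :=
  (List.ofFn fun i => FreeMonoid.lift (X i) (α i)).prod

/-- `X_{1,β₁}^* ⋯ X_{k,β_k}^*`. -/
def wordProdStar (X : OpTuple n H) (β : (i : Fin k) → FreeMonoid (Fin (n i))) : H →L[ℂ] H :=
  (List.ofFn fun i => star (FreeMonoid.lift (X i) (β i))).prod

/-- The part of multi-degree `s ∈ ℤ^k`:
`∑ A_{(α,β)} ⊗ X_{1,α₁} ⋯ X_{k,α_k} X_{1,β₁}^* ⋯ X_{k,β_k}^*`, the sum over all words with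
`|α_i| = s_i^+` and `|β_i| = s_i^-`. -/
def homogeneousPart
    (A : ((i : Fin k) → FreeMonoid (Fin (n i))) → ((i : Fin k) → FreeMonoid (Fin (n i))) →
      (K →L[ℂ] K))
    (X : OpTuple n H) (s : Fin k → ℤ) : HilbertTensor K H →L[ℂ] HilbertTensor K H :=
  ∑ α ∈ Fintype.piFinset fun i => wordsOfLength (n i) (s i).toNat,
    ∑ β ∈ Fintype.piFinset fun i => wordsOfLength (n i) (-s i).toNat,
      opTensor (A α β) (wordProd X α * wordProdStar X β)

/-- `F` is (the representation on `H` of) a free `k`-pluriharmonic function on the radial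
poly-hyperball with coefficients in `B(K)`; the series converges in the operator norm. Only the
values of `F` on the radial poly-hyperball matter. -/
def IsFreePluriharmonic (m : Fin k → ℕ)
    (F : OpTuple n H → (HilbertTensor K H →L[ℂ] HilbertTensor K H)) : Prop :=
  ∃ A : ((i : Fin k) → FreeMonoid (Fin (n i))) → ((i : Fin k) → FreeMonoid (Fin (n i))) →
      (K →L[ℂ] K),
    ∀ X ∈ radialPolyHyperball n m H, IteratedHasSum (homogeneousPart A X) (F X)

/-- `F` is bounded in operator norm on the radial poly-hyperball. -/
def IsBoundedOnRadial (m : Fin k → ℕ)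
    (F : OpTuple n H → (HilbertTensor K H →L[ℂ] HilbertTensor K H)) : Prop :=
  ∃ C : ℝ, ∀ X ∈ radialPolyHyperball n m H, ‖F X‖ ≤ C

end Pluriharmonic

/-- Convergence in the strong operator topology. -/
def SOTTendsto {ι E : Type*} [NormedAddCommGroup E] [NormedSpace ℂ E]
    (f : ι → (E →L[ℂ] E)) (l : Filter ι) (T : E →L[ℂ] E) : Prop :=
  ∀ x : E, Tendsto (fun i => f i x) l (𝓝 (T x))

end PolyHyperball

end

/-! A pure tuple `X` is a compression of a universal model `V` of weighted left creation operators
on `ℓ²(Words n, H)`, and for the model the radial limit is Abel summation along a grading.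

Write `b_l = multichoose (m i) l`, the coefficients of `(1 - t)^(-m i)`. Purity allows the inversion
of `(id - Φ)^m`, so that summing `b_{|α|} ‖R X_α^* h‖²` over all multi-words gives `‖h‖²`, where
`R^* R = Δ_X^m(1)`. Hence `J h = (√b_{|α|} R X_α^* h)_α` is an isometry, and the weights of `V` are
chosen so that `J X^* = V^* J` entrywise (`exists_berezinKernel`). In every term of the series the
adjoints stand on the right, so `F(rX) = (1 ⊗ J^*) F(rV) (1 ⊗ J)`. This requires `V` itself to lie
in the poly-hyperball (`modelTuple_mem_polyHyperball`) and to act on `H`; as `ℓ²(Words n, H)` is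
separable and infinite-dimensional, a unitary moves it there.

For the model, word length grades the space by `ℤ^k`, and the part of multi-degree `s` shifts
degrees by `s`. If `x` has degree `γ`, the component of `F(rV) x` in degree `δ` is therefore a
single term, `r^|δ - γ|` times a fixed vector, with `|·|` the `ℓ¹` norm. Boundedness of `F` makes
these vectors square-summable, and dominated convergence gives the limit
(`IsResolution.exists_tendsto`). Homogeneous vectors span a dense subspace, and the uniform bound
extends convergence to all vectors (`exists_tendsto_of_graded`). -/

noncomputable section

namespace PolyHyperball

/-! ### Operators on the Hilbert tensor product -/

section Tensor

variable {K H : Type*} [NormedAddCommGroup K] [InnerProductSpace ℂ K]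
  [NormedAddCommGroup H] [InnerProductSpace ℂ H]

theorem HilbertTensor.clm_ext {G : Type*} [NormedAddCommGroup G] [NormedSpace ℂ G]
    {S T : HilbertTensor K H →L[ℂ] G}
    (h : ∀ (x : K) (y : H), S ((x ⊗ₜ[ℂ] y : K ⊗[ℂ] H) : HilbertTensor K H)
      = T ((x ⊗ₜ[ℂ] y : K ⊗[ℂ] H) : HilbertTensor K H)) : S = T := by
  ext z
  induction z using UniformSpace.Completion.induction_on with
  | hp => exact isClosed_eq S.continuous T.continuous
  | ih z =>
    induction z with
    | zero => rw [UniformSpace.Completion.coe_zero, map_zero, map_zero]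
    | tmul x y => exact h x y
    | add a b ha hb => simp only [UniformSpace.Completion.coe_add, map_add, ha, hb]

theorem opTensor_mul (A A' : K →L[ℂ] K) (B B' : H →L[ℂ] H) :
    opTensor (A * A') (B * B') = opTensor A B * opTensor A' B' :=
  HilbertTensor.clm_ext fun x y => by simp [opTensor_tmul]

theorem opTensor_smul_right (A : K →L[ℂ] K) (c : ℂ) (B : H →L[ℂ] H) :
    opTensor A (c • B) = c • opTensor A B :=
  HilbertTensor.clm_ext fun x y => by simp [opTensor_tmul, UniformSpace.Completion.coe_smul]

theorem opTensor_zero_right (A : K →L[ℂ] K) : opTensor A (0 : H →L[ℂ] H) = 0 :=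
  HilbertTensor.clm_ext fun x y => by simp [opTensor_tmul]

theorem opTensor_star [CompleteSpace K] [CompleteSpace H] (A : K →L[ℂ] K) (B : H →L[ℂ] H) :
    star (opTensor A B) = opTensor (star A) (star B) := by
  rw [ContinuousLinearMap.star_eq_adjoint, eq_comm, ContinuousLinearMap.eq_adjoint_iff]
  intro z w
  induction z, w using UniformSpace.Completion.induction_on₂ with
  | hp => exact isClosed_eq (by fun_prop) (by fun_prop)
  | ih z w =>
    induction z with
    | zero => rw [UniformSpace.Completion.coe_zero, map_zero, inner_zero_left, inner_zero_left]
    | add a b ha hb =>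
      simp only [UniformSpace.Completion.coe_add, map_add, inner_add_left, ha, hb]
    | tmul x y =>
      induction w with
      | zero => rw [UniformSpace.Completion.coe_zero, map_zero, inner_zero_right, inner_zero_right]
      | add a b ha hb =>
        simp only [UniformSpace.Completion.coe_add, map_add, inner_add_right, ha, hb]
      | tmul x' y' =>
        simp [opTensor_tmul, UniformSpace.Completion.inner_coe,
          ContinuousLinearMap.star_eq_adjoint, ContinuousLinearMap.adjoint_inner_left]

theorem HilbertTensor.topologicalClosure_span_tmul :
    (Submodule.span ℂ {z : HilbertTensor K H | ∃ x y, z = ((x ⊗ₜ[ℂ] y : K ⊗[ℂ] H) :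
      HilbertTensor K H)}).topologicalClosure = ⊤ := by
  rw [eq_top_iff]
  rintro z -
  induction z using UniformSpace.Completion.induction_on with
  | hp => exact Submodule.isClosed_topologicalClosure _
  | ih z =>
    refine Submodule.le_topologicalClosure _ ?_
    induction z with
    | zero => rw [UniformSpace.Completion.coe_zero]; exact zero_mem _
    | tmul x y => exact Submodule.subset_span ⟨x, y, rfl⟩
    | add a b ha hb =>
      rw [UniformSpace.Completion.coe_add]
      exact add_mem ha hb

theorem HilbertTensor.continuous_tmul_right (x : K) :
    Continuous fun y : H => ((x ⊗ₜ[ℂ] y : K ⊗[ℂ] H) : HilbertTensor K H) :=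
  (UniformSpace.Completion.continuous_coe _).comp
    (TensorProduct.continuous_tmul.comp (by fun_prop : Continuous fun y : H => (x, y)))

end Tensor

/-! ### Strong limits from a dense subspace -/

section PointwiseLimits

variable {ι E G : Type*} [NormedAddCommGroup E] [NormedSpace ℂ E]
  [NormedAddCommGroup G] [NormedSpace ℂ G]

/-- The vectors at which an eventually bounded family of operators tends to `0` form a closed
subspace. -/
theorem tendsto_zero_of_mem_topologicalClosure {l : Filter ι} {T : ι → (E →L[ℂ] G)} {C : ℝ}
    (hT : ∀ᶠ i in l, ‖T i‖ ≤ C) {s : Set E} (hs : ∀ x ∈ s, Tendsto (fun i => T i x) l (𝓝 0))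
    {x : E} (hx : x ∈ (Submodule.span ℂ s).topologicalClosure) :
    Tendsto (fun i => T i x) l (𝓝 0) := by
  have hspan : ∀ y ∈ Submodule.span ℂ s, Tendsto (fun i => T i y) l (𝓝 0) := by
    intro y hy
    induction hy using Submodule.span_induction with
    | mem y hy => exact hs y hy
    | zero => simpa using tendsto_const_nhds
    | add a b _ _ ha hb => simpa using ha.add hb
    | smul c a _ ha => simpa using ha.const_smul c
  rw [Metric.tendsto_nhds]
  intro ε hε
  have hC : 0 < |C| + 1 := by positivity
  obtain ⟨y, hy, hxy⟩ := Metric.mem_closure_iff.1 hx (ε / (2 * (|C| + 1))) (by positivity)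
  have h1 := (Metric.tendsto_nhds.1 (hspan y hy)) (ε / 2) (by positivity)
  filter_upwards [h1, hT] with i hi hTi
  rw [dist_zero_right] at hi ⊢
  have h2 : T i x = T i (x - y) + T i y := by rw [map_sub]; abel
  have h3 : ‖T i (x - y)‖ ≤ (|C| + 1) * ‖x - y‖ :=
    (T i).le_of_opNorm_le (hTi.trans (by linarith [le_abs_self C])) _
  rw [dist_eq_norm, lt_div_iff₀ (by positivity)] at hxy
  have h4 := norm_add_le (T i (x - y)) (T i y)
  rw [h2]
  nlinarith

/-- The vectors at which a bounded family of operators converges pointwise form a closed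
subspace. -/
theorem exists_tendsto_of_mem_topologicalClosure [CompleteSpace G] {l : Filter ι} [l.NeBot]
    {T : ι → (E →L[ℂ] G)} {C : ℝ}
    (hT : ∀ᶠ i in l, ‖T i‖ ≤ C) {s : Set E} (hs : ∀ x ∈ s, ∃ y, Tendsto (fun i => T i x) l (𝓝 y))
    {x : E} (hx : x ∈ (Submodule.span ℂ s).topologicalClosure) :
    ∃ y, Tendsto (fun i => T i x) l (𝓝 y) := by
  -- The Cauchy criterion is convergence to `0` of the differences along `l ×ˢ l`, which reduces the
  -- claim to null families.
  suffices h : Tendsto (fun p : ι × ι => (T p.1 - T p.2) x) (l ×ˢ l) (𝓝 0) by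
    refine cauchy_map_iff_exists_tendsto.1 (cauchy_map_iff.2 ⟨inferInstance, ?_⟩)
    rw [uniformity_eq_comap_nhds_zero, tendsto_comap_iff]
    have := h.neg
    simpa [Function.comp_def] using this
  refine tendsto_zero_of_mem_topologicalClosure (C := C + C) (s := s) ?_ ?_ hx
  · filter_upwards [hT.prod_mk hT] with p hp
    exact (norm_sub_le _ _).trans (add_le_add hp.1 hp.2)
  · intro y hy
    obtain ⟨z, hz⟩ := hs y hy
    simpa using (hz.comp tendsto_fst).sub (hz.comp tendsto_snd)

end PointwiseLimits

/-! ### Orthogonal resolutions of the identity and Abel summation -/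

section Resolution

variable {ι H : Type*} [NormedAddCommGroup H] [InnerProductSpace ℂ H] [CompleteSpace H]

/-- A family of mutually orthogonal projections with strong sum `1`. -/
structure IsResolution (Q : ι → (H →L[ℂ] H)) : Prop where
  proj : ∀ i, IsStarProjection (Q i)
  orthogonal : ∀ i j, i ≠ j → Q i * Q j = 0
  hasSum : ∀ x, HasSum (fun i => Q i x) x

theorem isStarProjection_sum {Q : ι → (H →L[ℂ] H)} (hQ : ∀ i, IsStarProjection (Q i))
    (hQ' : ∀ i j, i ≠ j → Q i * Q j = 0) (s : Finset ι) : IsStarProjection (∑ i ∈ s, Q i) := by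
  classical
  refine ⟨?_, ?_⟩
  · rw [IsIdempotentElem, Finset.sum_mul_sum]
    refine Finset.sum_congr rfl fun i hi => ?_
    rw [Finset.sum_eq_single i (fun j _ hj => hQ' i j hj.symm) (fun h => absurd hi h)]
    exact (hQ i).isIdempotentElem
  · rw [isSelfAdjoint_iff, star_sum]
    exact Finset.sum_congr rfl fun i _ => (hQ i).isSelfAdjoint

/-- The strong sum is clear on elementary tensors; it extends to the completion because finite
partial sums are projections, hence contractions. -/
theorem IsResolution.opTensor {K : Type*} [NormedAddCommGroup K] [InnerProductSpace ℂ K]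
    [CompleteSpace K] {Q : ι → (H →L[ℂ] H)} (hQ : IsResolution Q) :
    IsResolution fun i => opTensor (1 : K →L[ℂ] K) (Q i) := by
  have hproj (i) : IsStarProjection (PolyHyperball.opTensor (1 : K →L[ℂ] K) (Q i)) := by
    refine ⟨?_, ?_⟩
    · rw [IsIdempotentElem, ← opTensor_mul, (hQ.proj i).isIdempotentElem.eq, one_mul]
    · rw [isSelfAdjoint_iff, opTensor_star, (hQ.proj i).isSelfAdjoint.star_eq, star_one]
  have horth (i j) (hij : i ≠ j) : PolyHyperball.opTensor (1 : K →L[ℂ] K) (Q i) *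
      PolyHyperball.opTensor (1 : K →L[ℂ] K) (Q j) = 0 := by
    rw [← opTensor_mul, hQ.orthogonal i j hij, opTensor_zero_right]
  refine ⟨hproj, horth, fun x => ?_⟩
  have key : Tendsto (fun s : Finset ι =>
      (∑ i ∈ s, PolyHyperball.opTensor (1 : K →L[ℂ] K) (Q i) - 1) x) atTop (𝓝 0) := by
    refine tendsto_zero_of_mem_topologicalClosure (C := 1 + 1)
      (s := {z : HilbertTensor K H | ∃ x y, z = ((x ⊗ₜ[ℂ] y : K ⊗[ℂ] H) : HilbertTensor K H)})
      (.of_forall fun s => ?_) ?_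
      (by rw [HilbertTensor.topologicalClosure_span_tmul]; trivial)
    · refine (norm_sub_le _ _).trans (add_le_add ?_ ContinuousLinearMap.norm_id_le)
      exact (isStarProjection_sum hproj horth s).norm_le
    · rintro _ ⟨a, b, rfl⟩
      have h1 := (HilbertTensor.continuous_tmul_right (K := K) a).tendsto b |>.comp (hQ.hasSum b)
      have h2 := h1.sub_const ((a ⊗ₜ[ℂ] b : K ⊗[ℂ] H) : HilbertTensor K H)
      rw [sub_self] at h2
      refine h2.congr fun s => ?_
      simp only [Function.comp_apply, sub_apply, sum_apply,
        opTensor_tmul, one_apply_eq_self, TensorProduct.tmul_sum]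
      congr 1
      exact map_sum (UniformSpace.Completion.toComplL (𝕜 := ℂ) (E := K ⊗[ℂ] H)) _ _
  have := key.add_const x
  simpa [HasSum, sum_apply] using this

theorem IsResolution.inner_eq_zero {Q : ι → (H →L[ℂ] H)} (hQ : IsResolution Q) {i j : ι}
    (hij : i ≠ j) (x y : H) : inner ℂ (Q i x) (Q j y) = 0 := by
  have := (hQ.proj i).isSelfAdjoint
  rw [ContinuousLinearMap.isSelfAdjoint_iff'] at this
  rw [← this, ContinuousLinearMap.adjoint_inner_left, ← mul_apply_eq_comp,
    hQ.orthogonal i j hij]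
  simp

theorem IsResolution.inner_self {Q : ι → (H →L[ℂ] H)} (hQ : IsResolution Q) (i : ι)
    (x : H) : inner ℂ (Q i x) x = (‖Q i x‖ : ℂ) ^ 2 := by
  have h1 := (hQ.proj i).isSelfAdjoint
  have h2 := (hQ.proj i).isIdempotentElem.eq
  rw [ContinuousLinearMap.isSelfAdjoint_iff'] at h1
  conv_lhs => rw [← h2, mul_apply_eq_comp]
  nth_rw 1 [← h1]
  rw [ContinuousLinearMap.adjoint_inner_left]
  exact inner_self_eq_norm_sq_to_K _

theorem IsResolution.hasSum_norm_sq {Q : ι → (H →L[ℂ] H)} (hQ : IsResolution Q) (x : H) :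
    HasSum (fun i => ‖Q i x‖ ^ 2) (‖x‖ ^ 2) := by
  have h := (innerSL ℂ x).hasSum (hQ.hasSum x)
  have h2 := Complex.reCLM.hasSum h
  have e : ∀ i, Complex.reCLM (innerSL ℂ x (Q i x)) = ‖Q i x‖ ^ 2 := fun i => by
    rw [innerSL_apply_apply, ← inner_conj_symm, hQ.inner_self i x]
    simp [← Complex.ofReal_pow]
  simp only [e] at h2
  convert h2 using 1
  simp [inner_self_eq_norm_sq_to_K, ← Complex.ofReal_pow]

/-- Abel summation: a bounded family whose components in a resolution are `r ^ n i • c i` converges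
as `r → 1`. -/
theorem IsResolution.exists_tendsto {Q : ι → (H →L[ℂ] H)} (hQ : IsResolution Q) (n : ι → ℕ)
    (c : ι → H) (x : ℝ → H) {C : ℝ} (hC : ∀ r, 0 ≤ r → r < 1 → ‖x r‖ ≤ C)
    (hx : ∀ r : ℝ, 0 ≤ r → r < 1 → ∀ i, Q i (x r) = ((r : ℂ) ^ n i) • c i) :
    ∃ y, Tendsto x (𝓝[<] 1) (𝓝 y) := by
  have hev : ∀ᶠ r : ℝ in 𝓝[<] 1, 0 ≤ r ∧ r < 1 := by
    filter_upwards [Ioo_mem_nhdsLT (zero_lt_one' ℝ)] with r hr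
    exact ⟨hr.1.le, hr.2⟩
  -- Any `r` in `(0, 1)` works here: since `r ^ n i ≠ 0`, the vector `c i` inherits membership in
  -- the range of `Q i`.
  have hfix (i) : Q i (c i) = c i := by
    have h := hx (1 / 2) (by norm_num) (by norm_num) i
    have h2 := congrArg (Q i) h
    rw [← mul_apply_eq_comp, (hQ.proj i).isIdempotentElem.eq, h, map_smul] at h2
    exact (smul_right_injective H (pow_ne_zero _ (by norm_num)) h2).symm
  have hc0 (i j) (hij : i ≠ j) : Q i (c j) = 0 := by
    rw [← hfix j, ← mul_apply_eq_comp, hQ.orthogonal i j hij]; simp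
  have hpow (m : ℕ) : Tendsto (fun r : ℝ => (r : ℂ) ^ m) (𝓝[<] 1) (𝓝 1) := by
    have : Continuous fun r : ℝ => (r : ℂ) ^ m := by fun_prop
    simpa using (this.tendsto 1).mono_left nhdsWithin_le_nhds
  -- Bessel's inequality bounds each finite sum by `C ^ 2` for `r < 1`, and the bound survives `r →
  -- 1`.
  have hsum : Summable fun i => ‖c i‖ ^ 2 := by
    refine summable_of_sum_le (c := C ^ 2) (fun _ => by positivity) fun s => ?_
    have ht : Tendsto (fun r : ℝ => ∑ i ∈ s, ‖((r : ℂ) ^ n i) • c i‖ ^ 2) (𝓝[<] 1)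
        (𝓝 (∑ i ∈ s, ‖(1 : ℂ) • c i‖ ^ 2)) :=
      tendsto_finsetSum _ fun i _ => (((hpow (n i)).smul_const (c i)).norm).pow 2
    simp only [one_smul] at ht
    refine le_of_tendsto ht ?_
    filter_upwards [hev] with r hr
    calc ∑ i ∈ s, ‖((r : ℂ) ^ n i) • c i‖ ^ 2 = ∑ i ∈ s, ‖Q i (x r)‖ ^ 2 :=
          Finset.sum_congr rfl fun i _ => by rw [hx r hr.1 hr.2]
      _ ≤ ‖x r‖ ^ 2 := sum_le_hasSum s (fun _ _ => by positivity) (hQ.hasSum_norm_sq _)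
      _ ≤ C ^ 2 := by gcongr; exact hC r hr.1 hr.2
  have hV : OrthogonalFamily ℂ (fun i => (Q i).range) fun i => (Q i).range.subtypeₗᵢ := by
    rintro i j hij ⟨_, a, rfl⟩ ⟨_, b, rfl⟩
    exact hQ.inner_eq_zero hij a b
  obtain ⟨y, hy⟩ : Summable c :=
    (hV.summable_iff_norm_sq_summable (fun i => ⟨c i, c i, hfix i⟩)).2 hsum
  refine ⟨y, ?_⟩
  have hQy (i) : Q i y = c i := by
    have h := (Q i).hasSum hy
    refine h.unique ?_
    rw [← hfix i]
    simpa [hfix] using hasSum_single (f := fun j => Q i (c j)) i fun j hj => hc0 i j hj.symm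
  -- This sum is `‖x r - y‖ ^ 2` by Parseval; the dominating factor `4` comes from `|r ^ n i - 1| ≤
  -- 2`.
  have hd : Tendsto (fun r : ℝ => ∑' i, ‖(((r : ℂ) ^ n i) - 1) • c i‖ ^ 2) (𝓝[<] 1)
      (𝓝 (∑' i, ‖((1 : ℂ) - 1) • c i‖ ^ 2)) := by
    refine tendsto_tsum_of_dominated_convergence (bound := fun i => 4 * ‖c i‖ ^ 2)
      (hsum.mul_left 4)
      (fun i => (((((hpow (n i)).sub_const 1).smul_const (c i)).norm).pow 2)) ?_
    filter_upwards [hev] with r hr i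
    have h1 : ‖(r : ℂ) ^ n i - 1‖ ≤ 2 := by
      refine (norm_sub_le _ _).trans ?_
      rw [norm_pow, Complex.norm_real, Real.norm_of_nonneg hr.1, norm_one]
      linarith [pow_le_one₀ hr.1 hr.2.le (n := n i)]
    rw [norm_pow, norm_norm, norm_smul, mul_pow]
    gcongr
    nlinarith [norm_nonneg ((r : ℂ) ^ n i - 1)]
  rw [tendsto_iff_norm_sub_tendsto_zero]
  simp only [sub_self, zero_smul, norm_zero, ne_eq, OfNat.ofNat_ne_zero, not_false_eq_true,
    zero_pow, tsum_zero] at hd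
  have hd2 := hd.sqrt
  rw [Real.sqrt_zero] at hd2
  refine hd2.congr' ?_
  filter_upwards [hev] with r hr
  rw [← Real.sqrt_sq (norm_nonneg (x r - y)), ← (hQ.hasSum_norm_sq (x r - y)).tsum_eq]
  congr 1
  refine tsum_congr fun i => ?_
  rw [map_sub, hx r hr.1 hr.2, hQy, sub_smul, one_smul]

theorem IsResolution.topologicalClosure_span {Q : ι → (H →L[ℂ] H)} (hQ : IsResolution Q) :
    (Submodule.span ℂ {x : H | ∃ i, Q i x = x}).topologicalClosure = ⊤ := by
  rw [eq_top_iff]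
  rintro x -
  refine mem_closure_of_tendsto (hQ.hasSum x) (.of_forall fun s => ?_)
  refine sum_mem fun i _ => Submodule.subset_span ⟨i, ?_⟩
  rw [← mul_apply_eq_comp, (hQ.proj i).isIdempotentElem.eq]

end Resolution

/-! ### Iterated series -/

section IteratedSum

variable {E G : Type*} [AddCommGroup E] [TopologicalSpace E] [AddCommGroup G] [TopologicalSpace G]

theorem IteratedHasSum.map {M : Type*} [FunLike M E G] [AddMonoidHomClass M E G] (L : M)
    (hL : Continuous L) :
    ∀ {k : ℕ} {f : (Fin k → ℤ) → E} {a : E}, IteratedHasSum f a →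
      IteratedHasSum (fun s => L (f s)) (L a)
  | 0, _, _, h => congrArg (fun x => L x) h
  | _ + 1, _, a, ⟨g, hg, ha⟩ => ⟨fun s => L (g s), fun s => (hg s).map L hL, by
      simpa only [Function.comp_def, map_sum] using (hL.tendsto a).comp ha⟩

/-- Serves to collapse the series for one graded component: every inner sum with first index other
than `s₀ 0` vanishes by induction, so the outer partial sums are eventually constant. -/
theorem IteratedHasSum.eq_of_support [T2Space E] :
    ∀ {k : ℕ} {f : (Fin k → ℤ) → E} {a : E} (_ : IteratedHasSum f a) (s₀ : Fin k → ℤ)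
      (_ : ∀ s, s ≠ s₀ → f s = 0), a = f s₀
  | 0, f, a, h, s₀, _ => by
      rw [Subsingleton.elim s₀ Fin.elim0]; exact h.symm
  | k + 1, f, a, ⟨g, hg, ha⟩, s₀, hf => by
      have h0 (s : ℤ) (hs : s ≠ s₀ 0) : g s = 0 := by
        rw [(hg s).eq_of_support 0 fun t _ => ?_]
        all_goals
          refine hf _ fun h => hs ?_
          rw [← h, Fin.cons_zero]
      have h1 : g (s₀ 0) = f s₀ := by
        have := (hg (s₀ 0)).eq_of_support (Fin.tail s₀) fun t ht => hf _ fun h => ht ?_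
        · rwa [Fin.cons_self_tail] at this
        · rw [← h, Fin.tail_cons]
      refine tendsto_nhds_unique ha ((tendsto_const_nhds (x := f s₀)).congr' ?_)
      filter_upwards [eventually_ge_atTop (s₀ 0).natAbs] with N hN
      rw [Finset.sum_eq_single (s₀ 0) (fun s _ hs => h0 s hs), h1]
      intro h
      exact absurd (Finset.mem_Icc.2 ⟨by omega, by omega⟩) h

theorem IteratedHasSum.unique [T2Space E] :
    ∀ {k : ℕ} {f : (Fin k → ℤ) → E} {a b : E} (_ : IteratedHasSum f a) (_ : IteratedHasSum f b),
      a = b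
  | 0, _, _, _, h, h' => h.symm.trans h'
  | _ + 1, _, _, _, ⟨g, hg, ha⟩, ⟨g', hg', hb⟩ => by
      have : g = g' := funext fun s => (hg s).unique (hg' s)
      subst this
      exact tendsto_nhds_unique ha hb

end IteratedSum

/-! ### Operators that shift a grading -/

section Degree

variable {G A : Type*} [AddCommGroup G] [Ring A]

/-- `T` shifts the grading given by the projections `Q` by `d`. -/
def HasDegree (Q : G → A) (d : G) (T : A) : Prop := ∀ δ, Q (δ + d) * T = T * Q δ

theorem HasDegree.one (Q : G → A) : HasDegree Q 0 1 := fun δ => by simp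

theorem HasDegree.mul {Q : G → A} {d e : G} {S T : A} (hS : HasDegree Q d S)
    (hT : HasDegree Q e T) : HasDegree Q (d + e) (S * T) := fun δ => by
  rw [add_comm d e, ← add_assoc, ← mul_assoc, hS, mul_assoc, hT, mul_assoc]

theorem HasDegree.star [StarRing A] {Q : G → A} (hQ : ∀ δ, IsSelfAdjoint (Q δ)) {d : G} {T : A}
    (hT : HasDegree Q d T) : HasDegree Q (-d) (star T) := fun δ => by
  have h := congrArg Star.star (hT (δ + -d))
  rw [star_mul, star_mul, (hQ _).star_eq, (hQ _).star_eq, add_assoc, neg_add_cancel, add_zero] at h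
  exact h.symm

theorem HasDegree.list_prod {Q : G → A} : ∀ {k : ℕ} {d : Fin k → G} {T : Fin k → A}
    (_ : ∀ i, HasDegree Q (d i) (T i)), HasDegree Q (∑ i, d i) (List.ofFn T).prod
  | 0, _, _, _ => by simpa using HasDegree.one Q
  | k + 1, d, T, h => by
      rw [List.ofFn_succ, List.prod_cons, Fin.sum_univ_succ]
      exact (h 0).mul (HasDegree.list_prod fun i => h i.succ)

theorem HasDegree.freeMonoid_lift {Q : G → A} {ι : Type*} {d : G} {T : ι → A}
    (h : ∀ j, HasDegree Q d (T j)) (w : FreeMonoid ι) :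
    HasDegree Q (w.length • d) (FreeMonoid.lift T w) := by
  induction w using FreeMonoid.inductionOn' with
  | one => simpa using HasDegree.one Q
  | of_mul j w ih =>
    rw [map_mul, FreeMonoid.lift_eval_of, FreeMonoid.length_mul, FreeMonoid.length_of, add_smul,
      one_smul]
    exact (h j).mul ih

end Degree

/-! ### Intertwining and scaling of word products -/

section SemiconjList

theorem SemiconjBy.list_prod_ofFn {M : Type*} [Monoid M] {a : M} : ∀ {k : ℕ} {x y : Fin k → M}
    (_ : ∀ i, SemiconjBy a (x i) (y i)), SemiconjBy a (List.ofFn x).prod (List.ofFn y).prod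
  | 0, _, _, _ => by simp
  | k + 1, x, y, h => by
      rw [List.ofFn_succ, List.prod_cons, List.ofFn_succ, List.prod_cons]
      exact (h 0).mul_right (SemiconjBy.list_prod_ofFn fun i => h i.succ)

theorem SemiconjBy.freeMonoid_lift {M ι : Type*} [Monoid M] {a : M} {x y : ι → M}
    (h : ∀ i, SemiconjBy a (x i) (y i)) (w : FreeMonoid ι) :
    SemiconjBy a (FreeMonoid.lift x w) (FreeMonoid.lift y w) := by
  induction w using FreeMonoid.inductionOn' with
  | one => simp
  | of_mul j w ih =>
    simp only [map_mul, FreeMonoid.lift_eval_of]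
    exact (h j).mul_right ih

theorem semiconjBy_star {M : Type*} [Monoid M] [StarMul M] {a x y : M}
    (h : SemiconjBy a x y) : SemiconjBy (star a) (star y) (star x) := by
  have := congrArg star h.eq
  rw [star_mul, star_mul] at this
  exact this.symm

theorem list_prod_ofFn_smul {A : Type*} [Ring A] [Algebra ℂ A] (c : ℂ) :
    ∀ {k : ℕ} (p : Fin k → ℕ) (T : Fin k → A),
      (List.ofFn fun i => c ^ p i • T i).prod = c ^ (∑ i, p i) • (List.ofFn T).prod
  | 0, _, _ => by simp
  | k + 1, p, T => by
      rw [List.ofFn_succ, List.prod_cons, list_prod_ofFn_smul c (fun i => p i.succ),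
        Fin.sum_univ_succ, List.ofFn_succ, List.prod_cons, pow_add, smul_mul_smul_comm]

theorem freeMonoid_lift_smul {A ι : Type*} [Ring A] [Algebra ℂ A] (c : ℂ) (T : ι → A)
    (w : FreeMonoid ι) : FreeMonoid.lift (c • T) w = c ^ w.length • FreeMonoid.lift T w := by
  induction w using FreeMonoid.inductionOn' with
  | one => simp
  | of_mul j w ih =>
    simp only [map_mul, FreeMonoid.lift_eval_of, ih, FreeMonoid.length_mul, FreeMonoid.length_of,
      pow_add, pow_one, Pi.smul_apply, smul_mul_smul_comm]

end SemiconjList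

/-! ### Scaling, degree and compression of homogeneous parts -/

section HomogeneousPart

variable {k : ℕ} {n : Fin k → ℕ}
  {K : Type*} [NormedAddCommGroup K] [InnerProductSpace ℂ K]
  {H : Type*} [NormedAddCommGroup H] [InnerProductSpace ℂ H] [CompleteSpace H]

omit [CompleteSpace H] in
theorem wordProd_real_smul (r : ℝ) (X : OpTuple n H) (α : (i : Fin k) → FreeMonoid (Fin (n i))) :
    wordProd ((r : ℂ) • X) α = (r : ℂ) ^ (∑ i, (α i).length) • wordProd X α := by
  rw [wordProd, wordProd, ← list_prod_ofFn_smul]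
  congr 2
  funext i
  exact freeMonoid_lift_smul _ _ _

theorem wordProdStar_real_smul (r : ℝ) (X : OpTuple n H)
    (β : (i : Fin k) → FreeMonoid (Fin (n i))) :
    wordProdStar ((r : ℂ) • X) β = (r : ℂ) ^ (∑ i, (β i).length) • wordProdStar X β := by
  rw [wordProdStar, wordProdStar, ← list_prod_ofFn_smul]
  congr 2
  funext i
  rw [Pi.smul_apply, freeMonoid_lift_smul, star_smul, star_pow]
  simp

variable (A : ((i : Fin k) → FreeMonoid (Fin (n i))) → ((i : Fin k) → FreeMonoid (Fin (n i))) →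
      (K →L[ℂ] K))

/-- Each term contains `|α_i| + |β_i| = s_i^+ + s_i^- = |s_i|` factors from the `i`-th tuple, and
`r` is real, so adjoints scale in the same way. -/
theorem homogeneousPart_real_smul (r : ℝ) (X : OpTuple n H) (s : Fin k → ℤ) :
    homogeneousPart A ((r : ℂ) • X) s
      = (r : ℂ) ^ (∑ i, (s i).natAbs) • homogeneousPart A X s := by
  simp only [homogeneousPart, Finset.smul_sum]
  refine Finset.sum_congr rfl fun α hα => Finset.sum_congr rfl fun β hβ => ?_
  have hα' (i) : (α i).length = (s i).toNat :=
    (mem_wordsOfLength _).1 (Fintype.mem_piFinset.1 hα i)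
  have hβ' (i) : (β i).length = (-s i).toNat :=
    (mem_wordsOfLength _).1 (Fintype.mem_piFinset.1 hβ i)
  rw [wordProd_real_smul, wordProdStar_real_smul, smul_mul_smul_comm, opTensor_smul_right,
    ← pow_add, ← Finset.sum_add_distrib]
  congr 2
  refine Finset.sum_congr rfl fun i _ => ?_
  rw [hα', hβ']
  omega

theorem hasDegree_wordProd_mul_wordProdStar {Q : (Fin k → ℤ) → (H →L[ℂ] H)}
    (hQ : ∀ δ, IsSelfAdjoint (Q δ)) {V : OpTuple n H}
    (hV : ∀ i j, HasDegree Q (Pi.single i 1) (V i j))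
    (α β : (i : Fin k) → FreeMonoid (Fin (n i))) :
    HasDegree Q (fun i => ((α i).length : ℤ) - (β i).length) (wordProd V α * wordProdStar V β) := by
  have h := (HasDegree.list_prod fun i => HasDegree.freeMonoid_lift (hV i) (α i)).mul
    (HasDegree.list_prod fun i => (HasDegree.freeMonoid_lift (hV i) (β i)).star hQ)
  convert h using 1
  rw [Finset.sum_neg_distrib, ← sub_eq_add_neg]
  · ext j
    simp [Finset.sum_apply, Pi.single_apply]
  · rfl

theorem opTensor_mul_homogeneousPart {Q : (Fin k → ℤ) → (H →L[ℂ] H)}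
    (hQ : ∀ δ, IsSelfAdjoint (Q δ)) {V : OpTuple n H}
    (hV : ∀ i j, HasDegree Q (Pi.single i 1) (V i j)) (s : Fin k → ℤ) :
    HasDegree (fun δ => opTensor (1 : K →L[ℂ] K) (Q δ)) s (homogeneousPart A V s) := by
  intro δ
  simp only [homogeneousPart, Finset.mul_sum, Finset.sum_mul]
  refine Finset.sum_congr rfl fun α hα => Finset.sum_congr rfl fun β hβ => ?_
  have hα' (i) : (α i).length = (s i).toNat :=
    (mem_wordsOfLength _).1 (Fintype.mem_piFinset.1 hα i)
  have hβ' (i) : (β i).length = (-s i).toNat :=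
    (mem_wordsOfLength _).1 (Fintype.mem_piFinset.1 hβ i)
  have h := hasDegree_wordProd_mul_wordProdStar hQ hV α β δ
  have hs : (fun i => ((α i).length : ℤ) - (β i).length) = s := by
    funext i
    rw [hα', hβ']
    omega
  rw [hs] at h
  rw [← opTensor_mul, ← opTensor_mul, h, one_mul, mul_one]

/-- The order of the factors is essential: `J^*` passes the unstarred word from the left, `J` passes
the starred word from the right, and they meet as `J^* J = 1`. -/
theorem homogeneousPart_eq_compression {J : H →L[ℂ] H} (hJ : star J * J = 1) {X V : OpTuple n H}
    (h : ∀ i j, SemiconjBy J (star (X i j)) (star (V i j))) (s : Fin k → ℤ) :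
    homogeneousPart A X s
      = opTensor 1 (star J) * homogeneousPart A V s * opTensor 1 J := by
  simp only [homogeneousPart, Finset.mul_sum, Finset.sum_mul]
  refine Finset.sum_congr rfl fun α _ => Finset.sum_congr rfl fun β _ => ?_
  have h' (i j) : SemiconjBy (star J) (V i j) (X i j) := by
    simpa using semiconjBy_star (h i j)
  have h1 : SemiconjBy (star J) (wordProd V α) (wordProd X α) :=
    SemiconjBy.list_prod_ofFn fun i => SemiconjBy.freeMonoid_lift (h' i) (α i)
  have h2 : SemiconjBy J (wordProdStar X β) (wordProdStar V β) :=
    SemiconjBy.list_prod_ofFn fun i => by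
      simpa using semiconjBy_star (SemiconjBy.freeMonoid_lift (h' i) (β i))
  rw [← opTensor_mul, ← opTensor_mul, ← mul_assoc, h1.eq, mul_assoc _ _ J, ← h2.eq, mul_assoc (wordProd X α),
    ← mul_assoc (star J), hJ, one_mul, one_mul, mul_one]

end HomogeneousPart

/-! ### Radial limits for graded tuples and their compressions -/

section Limit

variable {k : ℕ} {n m : Fin k → ℕ}
  {K : Type*} [NormedAddCommGroup K] [InnerProductSpace ℂ K] [CompleteSpace K]
  {H : Type*} [NormedAddCommGroup H] [InnerProductSpace ℂ H] [CompleteSpace H]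
  {F : OpTuple n H → (HilbertTensor K H →L[ℂ] HilbertTensor K H)}

theorem real_smul_mem_radialPolyHyperball {X : OpTuple n H} (hX : X ∈ polyHyperball n m H) {r : ℝ}
    (h0 : 0 ≤ r) (h1 : r < 1) : (r : ℂ) • X ∈ radialPolyHyperball n m H :=
  ⟨r, h0, h1, X, hX, rfl⟩

theorem exists_tendsto_of_graded (hF : IsFreePluriharmonic m F) (hFb : IsBoundedOnRadial m F)
    {V : OpTuple n H} (hVm : V ∈ polyHyperball n m H) {Q : (Fin k → ℤ) → (H →L[ℂ] H)}
    (hQ : IsResolution Q) (hV : ∀ i j, HasDegree Q (Pi.single i 1) (V i j))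
    (x : HilbertTensor K H) :
    ∃ y, Tendsto (fun r : ℝ => F ((r : ℂ) • V) x) (𝓝[<] 1) (𝓝 y) := by
  obtain ⟨A, hA⟩ := hF
  obtain ⟨C, hC⟩ := hFb
  set P : (Fin k → ℤ) → (HilbertTensor K H →L[ℂ] HilbertTensor K H) :=
    fun δ => opTensor (1 : K →L[ℂ] K) (Q δ)
  have hP : IsResolution P := hQ.opTensor
  have hdeg (s) : HasDegree P s (homogeneousPart A V s) :=
    opTensor_mul_homogeneousPart A (fun δ => (hQ.proj δ).isSelfAdjoint) hV s
  refine exists_tendsto_of_mem_topologicalClosure (C := C) (s := {x | ∃ δ, P δ x = x}) ?_ ?_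
    (by rw [hP.topologicalClosure_span]; trivial)
  · filter_upwards [Ioo_mem_nhdsLT (zero_lt_one' ℝ)] with r hr
    exact hC _ (real_smul_mem_radialPolyHyperball hVm hr.1.le hr.2)
  · rintro x ⟨γ, hγ⟩
    -- Only multi-degree `δ - γ` carries a vector of degree `γ` to degree `δ`, which gives the
    -- exponent and the coefficient vector.
    refine hP.exists_tendsto (fun δ => ∑ i, ((δ - γ) i).natAbs)
      (fun δ => homogeneousPart A V (δ - γ) x) _ (C := C * ‖x‖) (fun r h0 h1 => ?_)
      fun r h0 h1 δ => ?_
    · exact (F ((r : ℂ) • V)).le_of_opNorm_le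
        (hC _ (real_smul_mem_radialPolyHyperball hVm h0 h1)) x
    · have h := hA _ (real_smul_mem_radialPolyHyperball hVm h0 h1)
      have hL := h.map ((P δ).comp (ContinuousLinearMap.apply ℂ (HilbertTensor K H) x))
        (ContinuousLinearMap.continuous _)
      have hs := fun s => homogeneousPart_real_smul A r V s
      have hPs (s) : P δ (homogeneousPart A V s x) = homogeneousPart A V s (P (δ - s) x) := by
        have := congrArg (fun T => T x) (hdeg s (δ - s))
        simpa using this
      have key := hL.eq_of_support (δ - γ) fun s hne => ?_
      · simp only [ContinuousLinearMap.comp_apply, ContinuousLinearMap.apply_apply, hs,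
          map_smul, hPs, sub_sub_cancel, hγ] at key
        exact key
      · have hne' : δ - s ≠ γ := fun h => hne (by rw [← h]; abel)
        simp only [ContinuousLinearMap.comp_apply, ContinuousLinearMap.apply_apply, hs,
          map_smul, hPs]
        have h0 : P (δ - s) x = 0 := by
          rw [← hγ, ← mul_apply_eq_comp, hP.orthogonal _ _ hne']; rfl
        simp [h0]

/-- A bounded free pluriharmonic function has radial strong limits at every tuple which is
co-extended isometrically by a graded tuple. -/
theorem exists_sotTendsto_of_dilation (hF : IsFreePluriharmonic m F)
    (hFb : IsBoundedOnRadial m F) {X V : OpTuple n H} (hX : X ∈ polyHyperball n m H)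
    (hVm : V ∈ polyHyperball n m H) {Q : (Fin k → ℤ) → (H →L[ℂ] H)}
    (hQ : IsResolution Q) (hV : ∀ i j, HasDegree Q (Pi.single i 1) (V i j))
    {J : H →L[ℂ] H} (hJ : star J * J = 1)
    (h : ∀ i j, SemiconjBy J (star (X i j)) (star (V i j))) :
    ∃ T : HilbertTensor K H →L[ℂ] HilbertTensor K H,
      SOTTendsto (fun r : ℝ => F ((r : ℂ) • X)) (𝓝[<] 1) T := by
  have hcomp (r : ℝ) (h0 : 0 ≤ r) (h1 : r < 1) : F ((r : ℂ) • X) =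
      opTensor 1 (star J) * F ((r : ℂ) • V) * opTensor 1 J := by
    obtain ⟨A, hA⟩ := hF
    have hX' := hA _ (real_smul_mem_radialPolyHyperball hX h0 h1)
    have hV' := hA _ (real_smul_mem_radialPolyHyperball hVm h0 h1)
    refine hX'.unique ?_
    have := hV'.map ((AddMonoidHom.mulRight (opTensor (1 : K →L[ℂ] K) J)).comp
      (AddMonoidHom.mulLeft (opTensor (1 : K →L[ℂ] K) (star J))))
      ((continuous_const.clm_comp continuous_id).clm_comp continuous_const)
    refine (congrArg₂ IteratedHasSum ?_ rfl).mpr this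
    funext s
    refine homogeneousPart_eq_compression A hJ (fun i j => ?_) s
    have := h i j
    simp only [Pi.smul_apply, star_smul]
    exact this.smul_right _
  have hlim (x) : ∃ y, Tendsto (fun r : ℝ => F ((r : ℂ) • X) x) (𝓝[<] 1) (𝓝 y) := by
    obtain ⟨y, hy⟩ := exists_tendsto_of_graded hF hFb hVm hQ hV (opTensor 1 J x)
    refine ⟨opTensor 1 (star J) y, (((opTensor 1 (star J)).continuous.tendsto y).comp hy).congr' ?_⟩
    filter_upwards [Ioo_mem_nhdsLT (zero_lt_one' ℝ)] with r hr
    rw [hcomp r hr.1.le hr.2]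
    rfl
  choose f hf using hlim
  -- Banach–Steinhaus makes the pointwise limit a bounded operator.
  exact ⟨continuousLinearMapOfTendsto (fun r : ℝ => F ((r : ℂ) • X)) (tendsto_pi_nhds.2 hf), hf⟩

end Limit

/-! ### Weighted composition operators on `ℓ²` -/

section WeightedComp

variable {ι H : Type*} [NormedAddCommGroup H] [InnerProductSpace ℂ H]

/-- Injectivity is needed only where the weight is nonzero. This matters for removal of a first
letter, which is injective only among words with a prescribed first letter. -/
theorem sum_norm_weighted_le {σ : ι → ι} {w : ι → ℝ} (hσ : Set.InjOn σ {α | w α ≠ 0})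
    (hw : ∀ α, |w α| ≤ 1) (x : lp (fun _ : ι => H) 2) (s : Finset ι) :
    ∑ α ∈ s, ‖(w α : ℂ) • x (σ α)‖ ^ (2 : ENNReal).toReal ≤ ‖x‖ ^ (2 : ENNReal).toReal := by
  classical
  calc ∑ α ∈ s, ‖(w α : ℂ) • x (σ α)‖ ^ (2 : ENNReal).toReal
      = ∑ α ∈ s with w α ≠ 0, ‖(w α : ℂ) • x (σ α)‖ ^ (2 : ENNReal).toReal := by
        rw [Finset.sum_filter_of_ne]
        intro α _ h h0
        exact h (by simp [h0])
    _ ≤ ∑ α ∈ s with w α ≠ 0, ‖x (σ α)‖ ^ (2 : ENNReal).toReal := by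
        refine Finset.sum_le_sum fun α _ => ?_
        gcongr
        rw [norm_smul, Complex.norm_real, Real.norm_eq_abs]
        exact mul_le_of_le_one_left (norm_nonneg _) (hw α)
    _ = ∑ β ∈ (s.filter fun α => w α ≠ 0).image σ, ‖x β‖ ^ (2 : ENNReal).toReal := by
        rw [Finset.sum_image]
        intro a ha b hb hab
        exact hσ (by simpa using (Finset.mem_filter.1 ha).2)
          (by simpa using (Finset.mem_filter.1 hb).2) hab
    _ ≤ _ := lp.sum_rpow_le_norm_rpow (by simp) x _

/-- The weighted composition operator `x ↦ w • (x ∘ σ)` on `ℓ²(ι, H)`. -/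
def weightedComp (σ : ι → ι) (w : ι → ℝ) (hσ : Set.InjOn σ {α | w α ≠ 0})
    (hw : ∀ α, |w α| ≤ 1) : lp (fun _ : ι => H) 2 →L[ℂ] lp (fun _ : ι => H) 2 :=
  LinearMap.mkContinuous
    { toFun := fun x => ⟨fun α => (w α : ℂ) • x (σ α),
        memℓp_gen' fun s => sum_norm_weighted_le hσ hw x s⟩
      map_add' := fun x y => by ext α; exact smul_add _ _ _
      map_smul' := fun c x => by ext α; simp [smul_comm c] }
    1 fun x => by
      rw [one_mul]
      exact lp.norm_le_of_forall_sum_le (by simp) (norm_nonneg _)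
        fun s => sum_norm_weighted_le hσ hw x s

@[simp]
theorem weightedComp_apply (σ : ι → ι) (w : ι → ℝ) (hσ : Set.InjOn σ {α | w α ≠ 0})
    (hw : ∀ α, |w α| ≤ 1) (x : lp (fun _ : ι => H) 2) (α : ι) :
    weightedComp σ w hσ hw x α = (w α : ℂ) • x (σ α) := rfl

theorem weightedComp_star [CompleteSpace H] {σ σ' : ι → ι} {w w' : ι → ℝ}
    (hσ : Set.InjOn σ {α | w α ≠ 0})
    (hw : ∀ α, |w α| ≤ 1) (hσ' : Set.InjOn σ' {α | w' α ≠ 0}) (hw' : ∀ α, |w' α| ≤ 1)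
    (h1 : ∀ α, σ' (σ α) = α) (h2 : ∀ α, w' (σ α) = w α) (h3 : ∀ β, w' β ≠ 0 → σ (σ' β) = β) :
    star (weightedComp (H := H) σ w hσ hw) = weightedComp σ' w' hσ' hw' := by
  rw [ContinuousLinearMap.star_eq_adjoint, eq_comm, ContinuousLinearMap.eq_adjoint_iff]
  intro y x
  rw [lp.inner_eq_tsum, lp.inner_eq_tsum, ← (Function.LeftInverse.injective h1).tsum_eq]
  · refine tsum_congr fun α => ?_
    simp only [weightedComp_apply, h1, h2, inner_smul_left, inner_smul_right, Complex.conj_ofReal]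
  · intro β hβ
    refine ⟨σ' β, h3 β fun h0 => hβ ?_⟩
    simp [weightedComp_apply, h0]

end WeightedComp

/-! ### Grading projections on `ℓ²` -/

section Projections

variable {ι G H : Type*} [NormedAddCommGroup H] [InnerProductSpace ℂ H]

open Classical in
/-- The projection of `ℓ²(ι, H)` onto the vectors supported on `{α | deg α = δ}`. -/
def gradeProj (deg : ι → G) (δ : G) : lp (fun _ : ι => H) 2 →L[ℂ] lp (fun _ : ι => H) 2 :=
  weightedComp id (fun α => if deg α = δ then 1 else 0) (Function.injective_id.injOn)
    fun α => by split_ifs <;> simp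

open Classical in
theorem gradeProj_apply (deg : ι → G) (δ : G) (x : lp (fun _ : ι => H) 2) (α : ι) :
    gradeProj deg δ x α = if deg α = δ then x α else 0 := by
  simp [gradeProj]

theorem isResolution_gradeProj [CompleteSpace H] (deg : ι → G) :
    IsResolution (gradeProj (H := H) deg) := by
  classical
  refine ⟨fun δ => ⟨?_, ?_⟩, fun δ ε h => ?_, fun x => ?_⟩
  · ext x α
    simp only [mul_apply_eq_comp, gradeProj_apply]
    split_ifs <;> rfl
  · exact weightedComp_star _ _ _ _ (fun _ => rfl) (fun _ => rfl) fun _ _ => rfl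
  · ext x α
    simp only [mul_apply_eq_comp, gradeProj_apply]
    split_ifs with h1 h2
    · exact absurd (h1.symm.trans h2) h
    all_goals rfl
  · have h := lp.hasSum_single (p := 2) (by simp) x
    -- The coordinate expansion of `x` is grouped by the fibres of `deg`; each group sums to one
    -- projection of `x`.
    rw [← (Equiv.sigmaFiberEquiv deg).hasSum_iff] at h
    refine h.sigma fun δ => ?_
    have hδ := lp.hasSum_single (p := 2) (by simp) (gradeProj deg δ x)
    rw [← hasSum_subtype_iff_of_support_subset (s := {α | deg α = δ})] at hδ
    · have e : (fun c : {α // deg α = δ} => lp.single 2 c.1 (gradeProj deg δ x c.1)) =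
          fun c : {α // deg α = δ} => (lp.single 2 c.1 (x c.1) : lp (fun _ : ι => H) 2) :=
        funext fun c => congrArg (lp.single 2 c.1)
          ((gradeProj_apply deg δ x c.1).trans (if_pos c.2))
      exact e ▸ hδ
    · intro α hα
      by_contra h0
      have h1 : gradeProj deg δ x α = 0 := by rw [gradeProj_apply]; exact if_neg h0
      exact hα ((congrArg (lp.single 2 α) h1).trans (lp.single_zero 2 α))

end Projections

/-! ### The universal model of weighted creation operators -/

section Model

variable {k : ℕ} {n : Fin k → ℕ}

/-- The multi-indices of words. -/
abbrev Words (n : Fin k → ℕ) : Type := (i : Fin k) → FreeMonoid (Fin (n i))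

/-- The weight `√(b_l / b_{l+1})` of the model shift, for `b_l = multichoose (m i) l`, `l = |α_i|`. -/
def shiftWeight (m : Fin k → ℕ) (i : Fin k) (α : Words n) : ℝ :=
  √((m i).multichoose (α i).length / (m i).multichoose ((α i).length + 1))

theorem multichoose_pos {m : ℕ} (hm : 1 ≤ m) (l : ℕ) : 0 < m.multichoose l := by
  obtain ⟨m, rfl⟩ := Nat.exists_eq_add_of_le' hm
  induction l with
  | zero => simp
  | succ l ih => rw [Nat.multichoose_succ_succ]; omega

theorem shiftWeight_le_one (m : Fin k → ℕ) (i : Fin k) (α : Words n) :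
    |shiftWeight m i α| ≤ 1 := by
  rw [shiftWeight, abs_of_nonneg (Real.sqrt_nonneg _), Real.sqrt_le_one]
  rcases Nat.eq_zero_or_pos (m i) with h | h
  -- For `m i = 0` the denominator is `0`, so the weight is `0` by the convention on division.
  · simp [h]
  · refine div_le_one_of_le₀ ?_ (by positivity)
    obtain ⟨q, hq⟩ := Nat.exists_eq_add_of_le' h
    rw [hq, Nat.multichoose_succ_succ]
    push_cast
    linarith [Nat.cast_nonneg (α := ℝ) (q.multichoose ((α i).length + 1))]

/-- `α ↦ g_j α` in the `i`-th word. -/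
def consWord (i : Fin k) (j : Fin (n i)) (α : Words n) : Words n :=
  Function.update α i (FreeMonoid.of j * α i)

/-- Removal of the first letter of the `i`-th word. -/
def tailWord (i : Fin k) (α : Words n) : Words n :=
  Function.update α i (FreeMonoid.ofList (FreeMonoid.toList (α i)).tail)

/-- The first letter of the `i`-th word. -/
def headWord (i : Fin k) (α : Words n) : Option (Fin (n i)) := (FreeMonoid.toList (α i)).head?

theorem tailWord_consWord (i : Fin k) (j : Fin (n i)) (α : Words n) :
    tailWord i (consWord i j α) = α := by
  simp [tailWord, consWord]

theorem headWord_consWord (i : Fin k) (j : Fin (n i)) (α : Words n) :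
    headWord i (consWord i j α) = some j := by
  simp [headWord, consWord]

theorem consWord_tailWord {i : Fin k} {j : Fin (n i)} {α : Words n}
    (h : headWord i α = some j) : consWord i j (tailWord i α) = α := by
  obtain ⟨t, ht⟩ := List.head?_eq_some_iff.1 h
  have : α i = FreeMonoid.ofList (j :: t) := ht
  rw [tailWord, consWord, this, FreeMonoid.toList_ofList, List.tail_cons, Function.update_self,
    Function.update_idem, ← FreeMonoid.ofList_cons, ← this, Function.update_eq_self]

theorem length_consWord (i : Fin k) (j : Fin (n i)) (α : Words n) (i' : Fin k) :
    (consWord i j α i').length = (α i').length + if i' = i then 1 else 0 := by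
  by_cases h : i' = i
  · subst h
    simp [consWord, add_comm]
  · simp [consWord, h]

theorem consWord_injective (i : Fin k) (j : Fin (n i)) : Function.Injective (consWord i j) :=
  Function.LeftInverse.injective (tailWord_consWord i j)

variable {H : Type*} [NormedAddCommGroup H] [InnerProductSpace ℂ H]

/-- The adjoint of the weighted left creation operator. -/
def backwardShift (m : Fin k → ℕ) (i : Fin k) (j : Fin (n i)) :
    lp (fun _ : Words n => H) 2 →L[ℂ] lp (fun _ : Words n => H) 2 :=
  weightedComp (consWord i j) (shiftWeight m i) (consWord_injective i j).injOn
    (shiftWeight_le_one m i)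

/-- The weighted left creation operator. -/
def forwardShift (m : Fin k → ℕ) (i : Fin k) (j : Fin (n i)) :
    lp (fun _ : Words n => H) 2 →L[ℂ] lp (fun _ : Words n => H) 2 :=
  weightedComp (tailWord i)
    (fun β => if headWord i β = some j then shiftWeight m i (tailWord i β) else 0)
    (by
      intro a ha b hb hab
      have ha' : headWord i a = some j := by by_contra h; simp [h] at ha
      have hb' : headWord i b = some j := by by_contra h; simp [h] at hb
      rw [← consWord_tailWord ha', ← consWord_tailWord hb', hab])
    fun β => by
      split_ifs
      · exact shiftWeight_le_one m i _
      · simp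

theorem backwardShift_apply (m : Fin k → ℕ) (i : Fin k) (j : Fin (n i))
    (x : lp (fun _ : Words n => H) 2) (α : Words n) :
    backwardShift m i j x α = (shiftWeight m i α : ℂ) • x (consWord i j α) := rfl

theorem forwardShift_apply (m : Fin k → ℕ) (i : Fin k) (j : Fin (n i))
    (x : lp (fun _ : Words n => H) 2) (β : Words n) :
    forwardShift m i j x β =
      ((if headWord i β = some j then shiftWeight m i (tailWord i β) else 0 : ℝ) : ℂ) •
        x (tailWord i β) := rfl

variable [CompleteSpace H]

theorem star_backwardShift (m : Fin k → ℕ) (i : Fin k) (j : Fin (n i)) :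
    star (backwardShift (H := H) m i j) = forwardShift m i j :=
  weightedComp_star _ _ _ _ (tailWord_consWord i j)
    (fun α => by rw [if_pos (headWord_consWord i j α), tailWord_consWord])
    fun β hβ => consWord_tailWord (by by_contra h; simp [h] at hβ)

theorem star_forwardShift (m : Fin k → ℕ) (i : Fin k) (j : Fin (n i)) :
    star (forwardShift (H := H) m i j) = backwardShift m i j := by
  rw [← star_backwardShift, star_star]

/-- The universal model tuple on `ℓ²(Words n, H)`. -/
def modelTuple (n m : Fin k → ℕ) (H : Type*) [NormedAddCommGroup H] [InnerProductSpace ℂ H] :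
    OpTuple n (lp (fun _ : Words n => H) 2) := fun i j => forwardShift m i j

theorem shiftWeight_consWord_of_ne (m : Fin k → ℕ) {i i' : Fin k} (h : i ≠ i') (j : Fin (n i'))
    (α : Words n) : shiftWeight m i (consWord i' j α) = shiftWeight m i α := by
  simp [shiftWeight, length_consWord, h]

theorem modelTuple_commute (m : Fin k → ℕ) {i i' : Fin k} (h : i ≠ i') (a : Fin (n i))
    (b : Fin (n i')) : Commute (modelTuple n m H i a) (modelTuple n m H i' b) := by
  simp only [modelTuple]
  rw [← star_backwardShift, ← star_backwardShift, commute_star_star]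
  ext x α
  simp only [mul_apply_eq_comp, backwardShift_apply, smul_smul]
  rw [shiftWeight_consWord_of_ne m h, shiftWeight_consWord_of_ne m h.symm, mul_comm]
  congr 2
  simp only [consWord, Function.update_of_ne h, Function.update_of_ne h.symm]
  rw [Function.update_comm h]

/-- The multi-degree of a multi-index of words. -/
def wordDegree (α : Words n) (i : Fin k) : ℤ := (α i).length

theorem modelTuple_hasDegree (m : Fin k → ℕ) (i : Fin k) (j : Fin (n i)) :
    HasDegree (gradeProj (H := H) (wordDegree (n := n))) (Pi.single i 1) (modelTuple n m H i j) := by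
  -- The adjoint is treated first because its formula involves no case distinction on the first
  -- letter.
  have h : HasDegree (gradeProj (H := H) (wordDegree (n := n))) (-Pi.single i 1)
      (backwardShift m i j) := by
    intro δ
    ext x α
    have hd : wordDegree (consWord i j α) = wordDegree α + Pi.single i 1 := by
      funext i'
      simp [wordDegree, length_consWord, Pi.single_apply]
    simp only [mul_apply_eq_comp, backwardShift_apply, gradeProj_apply, hd,
      ← sub_eq_add_neg, eq_sub_iff_add_eq]
    split_ifs <;> simp
  have h2 := h.star fun δ => ((isResolution_gradeProj _).proj δ).isSelfAdjoint
  rwa [neg_neg, star_backwardShift] at h2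

/-- The diagonal coefficients of the images of `1` under the defect mappings of the model. -/
def diagCoeff (m q : Fin k → ℕ) (α : Words n) : ℝ :=
  ∏ i, ((q i).multichoose (α i).length / (m i).multichoose (α i).length : ℝ)

/-- `T` is the diagonal operator with coefficients `diagCoeff m q`. -/
def IsDiag (m q : Fin k → ℕ) (T : lp (fun _ : Words n => H) 2 →L[ℂ] lp (fun _ : Words n => H) 2) :
    Prop :=
  ∀ x α, T x α = (diagCoeff m q α : ℂ) • x α

theorem diagCoeff_nonneg (m q : Fin k → ℕ) (α : Words n) : 0 ≤ diagCoeff m q α :=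
  Finset.prod_nonneg fun _ _ => by positivity

omit [CompleteSpace H] in
theorem IsDiag.isPositive {m q : Fin k → ℕ}
    {T : lp (fun _ : Words n => H) 2 →L[ℂ] lp (fun _ : Words n => H) 2} (hT : IsDiag m q T) :
    T.IsPositive := by
  refine (ContinuousLinearMap.isPositive_iff_complex T).2 fun x => ?_
  have h : inner ℂ (T x) x = ((∑' α, diagCoeff m q α * ‖x α‖ ^ 2 : ℝ) : ℂ) := by
    rw [lp.inner_eq_tsum, Complex.ofReal_tsum]
    refine tsum_congr fun α => ?_
    rw [hT, inner_smul_left, inner_self_eq_norm_sq_to_K]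
    simp
  rw [h]
  refine ⟨by simp, ?_⟩
  simp only [RCLike.re_to_complex, Complex.ofReal_re]
  exact tsum_nonneg fun α => mul_nonneg (diagCoeff_nonneg _ _ _) (by positivity)

theorem diagCoeff_update (m q : Fin k → ℕ) (i : Fin k) (c : ℕ) (α : Words n) :
    diagCoeff m (Function.update q i c) α =
      (c.multichoose (α i).length / (m i).multichoose (α i).length) *
        ∏ i' ∈ Finset.univ.erase i,
          ((q i').multichoose (α i').length / (m i').multichoose (α i').length : ℝ) := by
  rw [diagCoeff, ← Finset.mul_prod_erase _ _ (Finset.mem_univ i), Function.update_self]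
  congr 1
  refine Finset.prod_congr rfl fun i' hi' => ?_
  rw [Function.update_of_ne (Finset.ne_of_mem_erase hi')]

/-- Pascal's rule in disguise. With `l + 1` the length of the `i`-th word, the squared weight `b_l /
b_{l+1}` replaces the denominator `b_l` by `b_{l+1}`, and `multichoose (c+1) (l+1) - multichoose
(c+1) l = multichoose c (l+1)`. -/
theorem IsDiag.sub_cpMap {m q : Fin k → ℕ} (hm : ∀ i, 1 ≤ m i)
    {T : lp (fun _ : Words n => H) 2 →L[ℂ] lp (fun _ : Words n => H) 2} {i : Fin k} {c : ℕ}
    (hT : IsDiag m (Function.update q i (c + 1)) T) :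
    IsDiag m (Function.update q i c) ((1 - cpMap (modelTuple n m H i)) T) := by
  intro x β
  have hsum : (cpMap (modelTuple n m H i) T) x β =
      ∑ j, (modelTuple n m H i j * T * star (modelTuple n m H i j)) x β := by
    rw [cpMap, LinearMap.coe_mk, AddHom.coe_mk, sum_apply, lp.coeFn_sum, Finset.sum_apply]
  have hterm (j) : (modelTuple n m H i j * T * star (modelTuple n m H i j)) x β =
      if headWord i β = some j then
        ((shiftWeight m i (tailWord i β) ^ 2 *
          diagCoeff m (Function.update q i (c + 1)) (tailWord i β) : ℝ) : ℂ) • x β else 0 := by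
    simp only [modelTuple, star_forwardShift, mul_apply_eq_comp]
    rw [forwardShift_apply, hT, backwardShift_apply]
    split_ifs with h
    · rw [consWord_tailWord h, smul_smul, smul_smul]
      push_cast
      ring_nf
    · simp
  have hgoal : (1 - cpMap (modelTuple n m H i)) T = T - cpMap (modelTuple n m H i) T := rfl
  rw [hgoal, sub_apply, lp.coeFn_sub, Pi.sub_apply, hT, hsum]
  simp only [hterm]
  rcases hh : headWord i β with _ | j
  -- On the empty word `Φ` contributes nothing, and `multichoose _ 0 = 1` makes both coefficients
  -- agree.
  · have hβ : β i = 1 := by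
      rw [headWord, List.head?_eq_none_iff] at hh
      exact hh
    simp [diagCoeff_update, hβ]
  · simp only [Option.some.injEq]
    rw [Finset.sum_ite_eq, if_pos (Finset.mem_univ _), ← sub_smul]
    congr 1
    set α := tailWord i β
    have hβ : consWord i j α = β := consWord_tailWord hh
    have hlen : (β i).length = (α i).length + 1 := by rw [← hβ, length_consWord, if_pos rfl]
    have hprod : ∏ i' ∈ Finset.univ.erase i,
          ((q i').multichoose (β i').length / (m i').multichoose (β i').length : ℝ) =
        ∏ i' ∈ Finset.univ.erase i,
          ((q i').multichoose (α i').length / (m i').multichoose (α i').length : ℝ) := by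
      refine Finset.prod_congr rfl fun i' hi' => ?_
      rw [← hβ, length_consWord, if_neg (Finset.ne_of_mem_erase hi'), add_zero]
    have hb0 := multichoose_pos (hm i) (α i).length
    have hb1 := multichoose_pos (hm i) ((α i).length + 1)
    rw [diagCoeff_update, diagCoeff_update, diagCoeff_update, hprod, hlen, shiftWeight,
      Real.sq_sqrt (by positivity), Nat.multichoose_succ_succ, ← Complex.ofReal_sub]
    congr 1
    have hb0' : ((m i).multichoose (α i).length : ℝ) ≠ 0 := by positivity
    have hb1' : ((m i).multichoose ((α i).length + 1) : ℝ) ≠ 0 := by positivity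
    push_cast
    field_simp
    ring

theorem IsDiag.sub_cpMap_pow {m q : Fin k → ℕ} (hm : ∀ i, 1 ≤ m i)
    {T : lp (fun _ : Words n => H) 2 →L[ℂ] lp (fun _ : Words n => H) 2} {i : Fin k}
    (hT : IsDiag m q T) (p : ℕ) (hp : p ≤ q i) :
    IsDiag m (Function.update q i (q i - p)) (((1 - cpMap (modelTuple n m H i)) ^ p) T) := by
  induction p with
  | zero => simpa using hT
  | succ p ih =>
    rw [pow_succ', Module.End.mul_apply]
    have h := ih (by omega)
    rw [show q i - p = (q i - (p + 1)) + 1 by omega] at h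
    exact h.sub_cpMap hm

theorem IsDiag.list_prod {m p : Fin k → ℕ} (hm : ∀ i, 1 ≤ m i) {q : Fin k → ℕ}
    {T : lp (fun _ : Words n => H) 2 →L[ℂ] lp (fun _ : Words n => H) 2}
    (hT : IsDiag m q T) (hp : p ≤ q) : ∀ L : List (Fin k), L.Nodup →
    IsDiag m (fun i => if i ∈ L then q i - p i else q i)
      ((L.map fun i => (1 - cpMap (modelTuple n m H i)) ^ p i).prod T)
  | [], _ => by simpa using hT
  | i :: L, hL => by
      obtain ⟨hi, hL'⟩ := List.nodup_cons.1 hL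
      have h := (IsDiag.list_prod hm hT hp L hL').sub_cpMap_pow (i := i) hm (p i)
        (by simpa [hi] using hp i)
      rw [List.map_cons, List.prod_cons, Module.End.mul_apply]
      convert h using 1
      funext i'
      by_cases h' : i' = i
      · subst h'; simp [hi]
      · simp [h']

omit [CompleteSpace H] in
theorem isDiag_one {m : Fin k → ℕ} (hm : ∀ i, 1 ≤ m i) :
    IsDiag (n := n) (H := H) m m 1 := by
  intro x α
  have : diagCoeff m m α = 1 := Finset.prod_eq_one fun i _ =>
    div_self (by exact_mod_cast (multichoose_pos (hm i) _).ne')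
  simp [this]

/-- Each factor `id - Φ` lowers one entry of `q` by one, starting from `q = m` for the identity; so
`Δ^p(1)` is diagonal with the nonnegative coefficients of `q = m - p`. -/
theorem modelTuple_mem_polyHyperball {m : Fin k → ℕ} (hm : ∀ i, 1 ≤ m i) :
    modelTuple n m H ∈ polyHyperball n m (lp (fun _ : Words n => H) 2) := by
  refine ⟨fun i j h a b => modelTuple_commute m h a b, fun p hp => ?_⟩
  rw [defectMap, List.ofFn_eq_map]
  exact ((isDiag_one hm).list_prod hm hp _ (List.nodup_finRange k)).isPositive

end Model

/-! ### Separable infinite-dimensional Hilbert spaces -/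

section SeparableHilbert

variable {H : Type*} [NormedAddCommGroup H] [InnerProductSpace ℂ H]

theorem countable_of_orthonormal [TopologicalSpace.SeparableSpace H] {ι : Type*} {v : ι → H}
    (hv : Orthonormal ℂ v) : Countable ι := by
  have hdist : ∀ i j, i ≠ j → ‖v i - v j‖ ^ 2 = 2 := fun i j hij => by
    rw [@norm_sub_sq ℂ, hv.1, hv.1, hv.2 hij]
    norm_num
  -- Orthonormal vectors are `√2` apart, so the balls of radius `1 / 2` about them are disjoint.
  refine Set.countable_univ_iff.1 (Set.PairwiseDisjoint.countable_of_isOpen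
    (s := fun i => Metric.ball (v i) (1 / 2)) ?_ (fun i _ => Metric.isOpen_ball)
    fun i _ => ⟨v i, Metric.mem_ball_self (by norm_num)⟩)
  intro i _ j _ hij
  refine Metric.ball_disjoint_ball ?_
  rw [dist_eq_norm]
  nlinarith [hdist i j hij, norm_nonneg (v i - v j)]

theorem exists_hilbertBasis_nat [CompleteSpace H] [TopologicalSpace.SeparableSpace H]
    (hH : ¬ FiniteDimensional ℂ H) : Nonempty (HilbertBasis ℕ ℂ H) := by
  obtain ⟨w, b, -⟩ := exists_hilbertBasis ℂ H
  have hc : Countable w := countable_of_orthonormal b.orthonormal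
  have hi : Infinite w := by
    by_contra h
    rw [not_infinite_iff_finite] at h
    have := Fintype.ofFinite w
    exact hH (Module.Basis.finiteDimensional_of_finite b.toOrthonormalBasis.toBasis)
  obtain ⟨e⟩ : Nonempty (ℕ ≃ w) := ⟨(nonempty_equiv_of_countable (α := w) (β := ℕ)).some.symm⟩
  refine ⟨HilbertBasis.mk (b.orthonormal.comp e e.injective) ?_⟩
  rw [e.surjective.range_comp, b.dense_span]

theorem nonempty_linearIsometryEquiv {E : Type*} [NormedAddCommGroup E] [InnerProductSpace ℂ E]
    [CompleteSpace E] [CompleteSpace H] [TopologicalSpace.SeparableSpace E]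
    [TopologicalSpace.SeparableSpace H] (hE : ¬ FiniteDimensional ℂ E)
    (hH : ¬ FiniteDimensional ℂ H) : Nonempty (E ≃ₗᵢ[ℂ] H) := by
  obtain ⟨b⟩ := exists_hilbertBasis_nat hE
  obtain ⟨b'⟩ := exists_hilbertBasis_nat hH
  exact ⟨b.repr.trans b'.repr.symm⟩

theorem separableSpace_lp {ι : Type*} [Countable ι] [TopologicalSpace.SeparableSpace H] :
    TopologicalSpace.SeparableSpace (lp (fun _ : ι => H) 2) := by
  classical
  have h1 : TopologicalSpace.IsSeparable
      (⋃ i : ι, Set.range fun a : H => (lp.single 2 i a : lp (fun _ : ι => H) 2)) :=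
    .iUnion fun i => TopologicalSpace.isSeparable_range
      (lp.singleContinuousLinearMap ℂ (fun _ : ι => H) 2 i).continuous
  have h2 := (h1.span (R := ℂ)).closure
  rw [← TopologicalSpace.isSeparable_univ_iff]
  refine h2.mono fun x _ => mem_closure_of_tendsto (lp.hasSum_single (by simp) x)
    (.of_forall fun s => sum_mem fun i _ => Submodule.subset_span ?_)
  exact Set.mem_iUnion.2 ⟨i, x i, rfl⟩

theorem not_finiteDimensional_lp {ι : Type*} [Nonempty ι] (hH : ¬ FiniteDimensional ℂ H) :
    ¬ FiniteDimensional ℂ (lp (fun _ : ι => H) 2) := by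
  classical
  intro h
  let i : ι := Classical.arbitrary ι
  refine hH (Module.Finite.of_injective
    (lp.singleContinuousLinearMap ℂ (fun _ : ι => H) 2 i).toLinearMap fun a b hab => ?_)
  have := congrArg (fun x : lp (fun _ : ι => H) 2 => x i) hab
  simpa using this

end SeparableHilbert

/-! ### Inversion of the defect map for pure tuples -/

section Kernel

variable {H : Type*} [NormedAddCommGroup H] [InnerProductSpace ℂ H] [CompleteSpace H]

/-- The quadratic form of an operator, truncated to `[0, ∞]`. -/
def quad (T : H →L[ℂ] H) (h : H) : ENNReal := ENNReal.ofReal (T.reApplyInnerSelf h)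

/-- The quadratic forms of a sequence of operators tend to `0`. -/
def IsNullSeq (T : ℕ → (H →L[ℂ] H)) : Prop :=
  ∀ h, Tendsto (fun l => (T l).reApplyInnerSelf h) atTop (𝓝 0)

omit [CompleteSpace H] in
theorem reApplyInnerSelf_sub (S T : H →L[ℂ] H) (h : H) :
    (S - T).reApplyInnerSelf h = S.reApplyInnerSelf h - T.reApplyInnerSelf h := by
  simp [ContinuousLinearMap.reApplyInnerSelf_apply, inner_sub_left]

omit [CompleteSpace H] in
theorem reApplyInnerSelf_sum {ι : Type*} (s : Finset ι) (T : ι → (H →L[ℂ] H)) (h : H) :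
    (∑ i ∈ s, T i).reApplyInnerSelf h = ∑ i ∈ s, (T i).reApplyInnerSelf h := by
  simp [ContinuousLinearMap.reApplyInnerSelf_apply, sum_inner]

theorem reApplyInnerSelf_conj (S T : H →L[ℂ] H) (h : H) :
    (S * T * star S).reApplyInnerSelf h = T.reApplyInnerSelf (star S h) := by
  simp only [ContinuousLinearMap.reApplyInnerSelf_apply, mul_apply_eq_comp]
  rw [← ContinuousLinearMap.adjoint_inner_right, ContinuousLinearMap.star_eq_adjoint]

theorem reApplyInnerSelf_cpMap {d : ℕ} (Z : Fin d → (H →L[ℂ] H)) (T : H →L[ℂ] H) (h : H) :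
    (cpMap Z T).reApplyInnerSelf h = ∑ j, T.reApplyInnerSelf (star (Z j) h) := by
  rw [cpMap, LinearMap.coe_mk, AddHom.coe_mk, reApplyInnerSelf_sum]
  simp only [reApplyInnerSelf_conj]

theorem isPositive_cpMap {d : ℕ} (Z : Fin d → (H →L[ℂ] H)) {T : H →L[ℂ] H} (hT : T.IsPositive) :
    (cpMap Z T).IsPositive := by
  rw [cpMap, LinearMap.coe_mk, AddHom.coe_mk]
  exact ContinuousLinearMap.isPositive_sum _ fun j _ => hT.conj_adjoint (Z j)

theorem isPositive_cpMap_pow {d : ℕ} (Z : Fin d → (H →L[ℂ] H)) {T : H →L[ℂ] H}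
    (hT : T.IsPositive) (l : ℕ) : ((cpMap Z ^ l) T).IsPositive := by
  induction l with
  | zero => simpa using hT
  | succ l ih =>
    rw [pow_succ', Module.End.mul_apply]
    exact isPositive_cpMap Z ih

theorem IsNullSeq.one_sub_cpMap_pow {d : ℕ} (Z : Fin d → (H →L[ℂ] H)) {T : ℕ → (H →L[ℂ] H)}
    (hT : IsNullSeq T) (p : ℕ) : IsNullSeq fun l => ((1 - cpMap Z) ^ p) (T l) := by
  induction p with
  | zero => simpa using hT
  | succ p ih =>
    intro h
    have e (l) : (((1 - cpMap Z) ^ (p + 1)) (T l)) =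
        ((1 - cpMap Z) ^ p) (T l) - cpMap Z (((1 - cpMap Z) ^ p) (T l)) := by
      rw [pow_succ', Module.End.mul_apply]; rfl
    simp only [e, reApplyInnerSelf_sub, reApplyInnerSelf_cpMap]
    simpa using (ih h).sub (tendsto_finsetSum Finset.univ fun j _ => ih (star (Z j) h))

theorem cpMap_pow_apply {d : ℕ} (Z : Fin d → (H →L[ℂ] H)) (T : H →L[ℂ] H) (l : ℕ) :
    (cpMap Z ^ l) T = ∑ w : Fin l → Fin d, FreeMonoid.lift Z (FreeMonoid.ofList (List.ofFn w)) * T *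
      star (FreeMonoid.lift Z (FreeMonoid.ofList (List.ofFn w))) := by
  induction l with
  | zero => simp
  | succ l ih =>
    rw [pow_succ', Module.End.mul_apply, ih, map_sum,
      ← (Fin.consEquiv fun _ : Fin (l + 1) => Fin d).sum_comp, Fintype.sum_prod_type,
      Finset.sum_comm]
    refine Finset.sum_congr rfl fun w _ => ?_
    rw [cpMap, LinearMap.coe_mk, AddHom.coe_mk]
    refine Finset.sum_congr rfl fun j _ => ?_
    have : FreeMonoid.lift Z (FreeMonoid.ofList (List.ofFn
        (Fin.consEquiv (fun _ : Fin (l + 1) => Fin d) (j, w)))) =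
        Z j * FreeMonoid.lift Z (FreeMonoid.ofList (List.ofFn w)) := by
      change FreeMonoid.lift Z (FreeMonoid.ofList (List.ofFn (Fin.cons j w))) = _
      rw [List.ofFn_cons, FreeMonoid.ofList_cons, map_mul,
        FreeMonoid.lift_eval_of]
    rw [this, star_mul]
    simp only [mul_assoc]

theorem quad_cpMap_pow {d : ℕ} (Z : Fin d → (H →L[ℂ] H)) {T : H →L[ℂ] H} (hT : T.IsPositive)
    (l : ℕ) (h : H) : quad ((cpMap Z ^ l) T) h = ∑ w : Fin l → Fin d,
      quad T (star (FreeMonoid.lift Z (FreeMonoid.ofList (List.ofFn w))) h) := by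
  rw [quad, cpMap_pow_apply, reApplyInnerSelf_sum]
  simp only [reApplyInnerSelf_conj]
  exact ENNReal.ofReal_sum_of_nonneg fun w _ => hT.re_inner_nonneg_left _

/-- Coefficientwise form of `(1 - t)^(-(M+1)) = (1 - t)^(-1) (1 - t)^(-M)`. -/
theorem multichoose_succ_eq_sum (M l : ℕ) :
    (M + 1).multichoose l = ∑ p ∈ Finset.HasAntidiagonal.antidiagonal l, M.multichoose p.2 := by
  induction l with
  | zero => simp
  | succ l ih =>
    rw [Nat.multichoose_succ_succ, Finset.Nat.antidiagonal_succ]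
    simp [ih]

theorem tsum_antidiagonal (f : ℕ → ℕ → ENNReal) :
    ∑' l, ∑ p ∈ Finset.HasAntidiagonal.antidiagonal l, f p.1 p.2 = ∑' j, ∑' l, f j l := by
  rw [← ENNReal.tsum_prod, ← Finset.HasAntidiagonal.sigmaAntidiagonalEquivProd.tsum_eq, ENNReal.tsum_sigma']
  refine tsum_congr fun l => ?_
  rw [tsum_fintype, ← Finset.sum_coe_sort]
  rfl

/-- The sum telescopes to `Y - Φ^l(Y)`, whose last term vanishes in the limit; positivity of the
terms permits sums in `[0, ∞]`. -/
theorem tsum_quad_sub {d : ℕ} (Z : Fin d → (H →L[ℂ] H)) {Y : H →L[ℂ] H}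
    (hY1 : ((1 - cpMap Z) Y).IsPositive) (hnull : IsNullSeq fun l => (cpMap Z ^ l) Y) (h : H) :
    ∑' l, quad ((cpMap Z ^ l) ((1 - cpMap Z) Y)) h = quad Y h := by
  have e (l) : ((cpMap Z ^ l) ((1 - cpMap Z) Y)).reApplyInnerSelf h =
      ((cpMap Z ^ l) Y).reApplyInnerSelf h - ((cpMap Z ^ (l + 1)) Y).reApplyInnerSelf h := by
    rw [← reApplyInnerSelf_sub, pow_succ, Module.End.mul_apply, ← map_sub]; rfl
  have hnn (l) : 0 ≤ ((cpMap Z ^ l) ((1 - cpMap Z) Y)).reApplyInnerSelf h :=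
    (isPositive_cpMap_pow Z hY1 l).re_inner_nonneg_left h
  have hs : HasSum (fun l => ((cpMap Z ^ l) ((1 - cpMap Z) Y)).reApplyInnerSelf h)
      (Y.reApplyInnerSelf h) := by
    rw [hasSum_iff_tendsto_nat_of_nonneg hnn]
    simp only [e, Finset.sum_range_sub']
    simpa using (hnull h).const_sub (Y.reApplyInnerSelf h)
  rw [quad, ← hs.tsum_eq, ENNReal.ofReal_tsum_of_nonneg hnn hs.summable]
  rfl

/-- A rigorous form of `(id - Φ)^(-M) = ∑ b_l Φ^l`, by induction on `M`: one factor is inverted by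
telescoping, the others by the induction hypothesis at `Φ^j((id - Φ) Y)`, and the double sum is
regrouped along antidiagonals. -/
theorem tsum_multichoose_quad_pow {d : ℕ} (Z : Fin d → (H →L[ℂ] H)) (M : ℕ) :
    ∀ (Y : H →L[ℂ] H) (_ : ∀ p ≤ M, (((1 - cpMap Z) ^ p) Y).IsPositive)
      (_ : IsNullSeq fun l => (cpMap Z ^ l) Y) (h : H),
    ∑' l, (M.multichoose l : ENNReal) * quad ((cpMap Z ^ l) (((1 - cpMap Z) ^ M) Y)) h
      = quad Y h := by
  have hcomm (j p : ℕ) : Commute (cpMap Z ^ j) ((1 - cpMap Z) ^ p) :=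
    ((Commute.one_right _).sub_right (Commute.refl _)).pow_pow j p
  induction M with
  | zero =>
    intro Y _ _ h
    rw [tsum_eq_single 0]
    · simp
    · intro l hl
      obtain ⟨l, rfl⟩ := Nat.exists_eq_succ_of_ne_zero hl
      simp
  | succ M ih =>
    intro Y hpos hnull h
    have hpos1 : ((1 - cpMap Z) Y).IsPositive := by simpa using hpos 1 (by omega)
    rw [← tsum_quad_sub Z hpos1 hnull h]
    have key (j) : ∑' l, (M.multichoose l : ENNReal) *
        quad ((cpMap Z ^ (j + l)) (((1 - cpMap Z) ^ (M + 1)) Y)) h =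
        quad ((cpMap Z ^ j) ((1 - cpMap Z) Y)) h := by
      rw [← ih ((cpMap Z ^ j) ((1 - cpMap Z) Y)) ?_ ?_ h]
      · refine tsum_congr fun l => ?_
        congr 2
        simp only [← Module.End.mul_apply]
        congr 1
        rw [add_comm, pow_add, pow_succ, mul_assoc, ← mul_assoc (cpMap Z ^ j), (hcomm j M).eq]
        simp only [mul_assoc]
      · intro p hp
        have := isPositive_cpMap_pow Z (hpos (p + 1) (by omega)) j
        rw [pow_succ] at this
        simp only [← Module.End.mul_apply] at this ⊢
        rwa [← mul_assoc, (hcomm j p).eq, mul_assoc] at this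
      · have := IsNullSeq.one_sub_cpMap_pow Z
          (T := fun l => (cpMap Z ^ (l + j)) Y) (fun h => (hnull h).comp (tendsto_add_atTop_nat j)) 1
        convert this using 2 with l
        simp only [← Module.End.mul_apply]
        rw [← mul_assoc, ← pow_add, ← (hcomm (l + j) 1).eq, pow_one]
    simp only [← key]
    rw [← tsum_antidiagonal]
    refine tsum_congr fun l => ?_
    rw [multichoose_succ_eq_sum, Nat.cast_sum, Finset.sum_mul]
    refine Finset.sum_congr rfl fun p hp => ?_
    rw [Finset.HasAntidiagonal.mem_antidiagonal.1 hp]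

theorem tsum_multichoose_quad_words {d : ℕ} (Z : Fin d → (H →L[ℂ] H)) (M : ℕ) {Y : H →L[ℂ] H}
    (hpos : ∀ p ≤ M, (((1 - cpMap Z) ^ p) Y).IsPositive)
    (hnull : IsNullSeq fun l => (cpMap Z ^ l) Y) (h : H) :
    ∑' α : FreeMonoid (Fin d), (M.multichoose α.length : ENNReal) *
      quad (((1 - cpMap Z) ^ M) Y) (star (FreeMonoid.lift Z α) h) = quad Y h := by
  rw [← tsum_multichoose_quad_pow Z M Y hpos hnull h]
  have h1 := (List.equivSigmaTuple (α := Fin d)).symm.tsum_eq fun α : List (Fin d) =>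
    (M.multichoose α.length : ENNReal) * quad (((1 - cpMap Z) ^ M) Y)
      (star (FreeMonoid.lift Z (FreeMonoid.ofList α)) h)
  refine h1.symm.trans ?_
  rw [ENNReal.tsum_sigma']
  refine tsum_congr fun l => ?_
  rw [quad_cpMap_pow Z (hpos M le_rfl), Finset.mul_sum, tsum_fintype]
  refine Finset.sum_congr rfl fun w _ => ?_
  simp [List.equivSigmaTuple]

theorem cpMap_commute {d d' : ℕ} {Z : Fin d → (H →L[ℂ] H)} {W : Fin d' → (H →L[ℂ] H)}
    (h : ∀ a b, Commute (Z a) (W b)) : Commute (cpMap Z) (cpMap W) := by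
  ext1 T
  simp only [Module.End.mul_apply]
  simp only [cpMap, LinearMap.coe_mk, AddHom.coe_mk, Finset.mul_sum, Finset.sum_mul]
  rw [Finset.sum_comm]
  refine Finset.sum_congr rfl fun b _ => Finset.sum_congr rfl fun a _ => ?_
  calc Z a * (W b * T * star (W b)) * star (Z a)
      = (Z a * W b) * T * star (Z a * W b) := by rw [star_mul]; simp only [mul_assoc]
    _ = (W b * Z a) * T * star (W b * Z a) := by rw [(h a b).eq]
    _ = _ := by rw [star_mul]; simp only [mul_assoc]

theorem defectMap_succ {k : ℕ} {n : Fin (k + 1) → ℕ} (p : Fin (k + 1) → ℕ) (X : OpTuple n H) :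
    defectMap p X = (1 - cpMap (X 0)) ^ p 0 *
      defectMap (n := fun i => n i.succ) (fun i => p i.succ) (fun i => X i.succ) := by
  rw [defectMap, List.ofFn_succ, List.prod_cons]
  rfl

theorem commute_list_prod_ofFn {M : Type*} [Monoid M] {a : M} {k : ℕ} {x : Fin k → M}
    (h : ∀ i, Commute a (x i)) : Commute a (List.ofFn x).prod :=
  SemiconjBy.list_prod_ofFn h

omit [CompleteSpace H] in
theorem wordProd_succ {k : ℕ} {n : Fin (k + 1) → ℕ} (X : OpTuple n H) (α : Words n) :
    wordProd X α = FreeMonoid.lift (X 0) (α 0) *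
      wordProd (n := fun i => n i.succ) (fun i => X i.succ) (fun i => α i.succ) := by
  rw [wordProd, List.ofFn_succ, List.prod_cons]
  rfl

/-- The weight `∏ b_{|α_i|}`, where `b_l = multichoose (m i) l`. -/
def wordWeight {k : ℕ} {n : Fin k → ℕ} (m : Fin k → ℕ) (α : Words n) : ℕ :=
  ∏ i, (m i).multichoose (α i).length

/-- Induction on the number of tuples: the first is inverted alone, the rest are applied to `(id -
Φ_{X₁})^{m₁} Y`. Cross-commutation of the entries makes the maps `Φ` commute, so both hypotheses on
`Y` pass to this operator. -/
theorem tsum_wordWeight_quad : ∀ {k : ℕ} {n m : Fin k → ℕ} {X : OpTuple n H}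
    (_ : ∀ i j : Fin k, i ≠ j → ∀ (a : Fin (n i)) (b : Fin (n j)), Commute (X i a) (X j b))
    {Y : H →L[ℂ] H} (_ : ∀ p : Fin k → ℕ, p ≤ m → (defectMap p X Y).IsPositive)
    (_ : ∀ i, IsNullSeq fun l => (cpMap (X i) ^ l) Y) (h : H),
    ∑' α : Words n, (wordWeight m α : ENNReal) * quad (defectMap m X Y) (star (wordProd X α) h)
      = quad Y h
  | 0, n, m, X, _, Y, _, _, h => by
      rw [tsum_fintype, Fintype.sum_unique]
      simp [wordWeight, defectMap, wordProd]
  | k + 1, n, m, X, hcomm, Y, hpos, hnull, h => by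
      have hc (q : ℕ) (p : Fin k → ℕ) : Commute ((1 - cpMap (X 0)) ^ q)
          (defectMap (n := fun i => n i.succ) p (fun i => X i.succ)) := by
        refine commute_list_prod_ofFn fun i => Commute.pow_pow ?_ _ _
        exact ((Commute.one_left _).sub_left ((Commute.one_right _).sub_right
          (cpMap_commute (hcomm 0 i.succ (Fin.succ_ne_zero i).symm))))
      have hD : defectMap m X Y = defectMap (n := fun i => n i.succ) (fun i => m i.succ)
          (fun i => X i.succ) (((1 - cpMap (X 0)) ^ m 0) Y) := by
        rw [defectMap_succ, (hc _ _).eq, Module.End.mul_apply]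
      have hpos0 : ∀ p ≤ m 0, (((1 - cpMap (X 0)) ^ p) Y).IsPositive := by
        intro p hp
        -- All mixed orders `p ≤ m` are needed: `(p, 0)` isolates the first tuple, and below `(m 0,
        -- p)` handles the others.
        have := hpos (Fin.cons p 0) (Fin.cons_le.2 ⟨hp, fun _ => Nat.zero_le _⟩)
        rw [defectMap_succ] at this
        simpa [defectMap] using this
      rw [← tsum_multichoose_quad_words (X 0) (m 0) hpos0 (hnull 0) h,
        ← (Fin.consEquiv fun i : Fin (k + 1) => FreeMonoid (Fin (n i))).tsum_eq,
        ENNReal.tsum_prod']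
      refine tsum_congr fun α₀ => ?_
      rw [← tsum_wordWeight_quad (n := fun i => n i.succ) (m := fun i => m i.succ)
        (X := fun i => X i.succ) (fun i j hij => hcomm _ _ ((Fin.succ_injective k).ne hij))
        (Y := ((1 - cpMap (X 0)) ^ m 0) Y) ?_ ?_ (star (FreeMonoid.lift (X 0) α₀) h),
        ← ENNReal.tsum_mul_left]
      · refine tsum_congr fun α => ?_
        rw [wordProd_succ, hD, wordWeight, Fin.prod_univ_succ, star_mul, mul_apply_eq_comp]
        simp only [Fin.consEquiv_apply, Fin.cons_zero, Fin.cons_succ, Nat.cast_mul, mul_assoc]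
        rfl
      · intro p hp
        have := hpos (Fin.cons (m 0) p) (Fin.cons_le.2 ⟨le_rfl, hp⟩)
        rw [defectMap_succ] at this
        simp only [Fin.cons_zero, Fin.cons_succ] at this
        rwa [(hc _ _).eq, Module.End.mul_apply] at this
      · intro i
        have h1 := (hnull i.succ).one_sub_cpMap_pow (X 0) (m 0)
        have h2 (l) : Commute (cpMap (X i.succ) ^ l) ((1 - cpMap (X 0)) ^ m 0) :=
          Commute.pow_pow ((Commute.one_right _).sub_right
            (cpMap_commute (hcomm i.succ 0 (Fin.succ_ne_zero i)))) _ _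
        simp only [← Module.End.mul_apply] at h1 ⊢
        simpa only [(h2 _).eq] using h1

end Kernel

/-! ### The Berezin kernel -/

section Berezin

variable {H : Type*} [NormedAddCommGroup H] [InnerProductSpace ℂ H]

theorem exists_linearIsometry_lp {ι : Type*} (T : ι → (H →L[ℂ] H))
    (hT : ∀ h, ∑' α, ENNReal.ofReal (‖T α h‖ ^ 2) = ENNReal.ofReal (‖h‖ ^ 2)) :
    ∃ J : H →ₗᵢ[ℂ] lp (fun _ : ι => H) 2, ∀ h α, J h α = T α h := by
  have hsum (h) : Summable fun α => ‖T α h‖ ^ 2 := by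
    have := ENNReal.summable_toReal (f := fun α => ENNReal.ofReal (‖T α h‖ ^ 2))
      (by rw [hT]; exact ENNReal.ofReal_ne_top)
    simpa [ENNReal.toReal_ofReal, sq_nonneg] using this
  have hmem (h) : Memℓp (fun α => T α h) 2 := memℓp_gen (by simpa using hsum h)
  refine ⟨⟨{ toFun := fun h => ⟨fun α => T α h, hmem h⟩
             map_add' := fun x y => by ext α; exact map_add _ _ _
             map_smul' := fun c x => by ext α; exact map_smul _ _ _ }, fun h => ?_⟩,
    fun h α => rfl⟩
  have h1 := lp.hasSum_norm (p := 2) (by simp) (⟨fun α => T α h, hmem h⟩ : lp (fun _ : ι => H) 2)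
  simp only [ENNReal.toReal_ofNat, Real.rpow_two] at h1
  have h2 := hT h
  rw [← ENNReal.ofReal_tsum_of_nonneg (fun _ => by positivity) (hsum h), h1.tsum_eq,
    ENNReal.ofReal_eq_ofReal_iff (by positivity) (by positivity)] at h2
  exact (pow_left_inj₀ (norm_nonneg _) (norm_nonneg _) two_ne_zero).1 h2

theorem list_prod_ofFn_update {M : Type*} [Monoid M] {a : M} : ∀ {k : ℕ} {f g : Fin k → M}
    {i : Fin k} (_ : ∀ j, j ≠ i → Commute a (f j)) (_ : g i = a * f i)
    (_ : ∀ j, j ≠ i → g j = f j), (List.ofFn g).prod = a * (List.ofFn f).prod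
  | 0, _, _, i, _, _, _ => i.elim0
  | k + 1, f, g, i, hc, hi, hg => by
      rw [List.ofFn_succ, List.prod_cons, List.ofFn_succ, List.prod_cons]
      induction i using Fin.cases with
      | zero =>
        rw [hi, mul_assoc, funext fun j => hg _ (Fin.succ_ne_zero j)]
      | succ i =>
        rw [hg 0 (Fin.succ_ne_zero i).symm, list_prod_ofFn_update (a := a)
          (f := fun j => f j.succ) (i := i)
          (fun j hj => hc _ ((Fin.succ_injective k).ne hj)) hi
          fun j hj => hg _ ((Fin.succ_injective k).ne hj), ← mul_assoc, ← mul_assoc,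
          (hc 0 (Fin.succ_ne_zero i).symm).eq]

variable {k : ℕ} {n m : Fin k → ℕ}

/-- The new letter reaches the front by commuting past the blocks of the other tuples; it need not
commute with its own block. -/
theorem wordProd_consWord {X : OpTuple n H}
    (hX : ∀ i j : Fin k, i ≠ j → ∀ (a : Fin (n i)) (b : Fin (n j)), Commute (X i a) (X j b))
    (i : Fin k) (j : Fin (n i)) (α : Words n) :
    wordProd X (consWord i j α) = X i j * wordProd X α := by
  refine list_prod_ofFn_update (i := i) (fun i' hi' => ?_) ?_ fun i' hi' => ?_
  · have := SemiconjBy.freeMonoid_lift (a := X i j) (x := X i') (y := X i')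
      (fun b => hX i i' hi'.symm j b) (α i')
    exact this
  · simp [consWord]
  · simp [consWord, hi']

/-- This identity dictates the choice of the shift weights: it is what makes the kernel intertwine
the adjoints. -/
theorem shiftWeight_mul_sqrt_wordWeight (hm : ∀ i, 1 ≤ m i) (i : Fin k) (j : Fin (n i))
    (α : Words n) :
    shiftWeight m i α * √(wordWeight m (consWord i j α)) = √(wordWeight m α) := by
  have h0 := multichoose_pos (hm i) ((α i).length + 1)
  rw [shiftWeight, ← Real.sqrt_mul (by positivity)]
  congr 1
  have hprod : ∏ i' ∈ Finset.univ.erase i, (m i').multichoose (consWord i j α i').length =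
      ∏ i' ∈ Finset.univ.erase i, (m i').multichoose (α i').length := by
    refine Finset.prod_congr rfl fun i' hi' => ?_
    rw [length_consWord, if_neg (Finset.ne_of_mem_erase hi'), add_zero]
  rw [wordWeight, wordWeight, ← Finset.mul_prod_erase _ _ (Finset.mem_univ i), hprod,
    ← Finset.mul_prod_erase _ (fun i => (m i).multichoose (α i).length) (Finset.mem_univ i),
    length_consWord, if_pos rfl]
  have h0' : ((m i).multichoose ((α i).length + 1) : ℝ) ≠ 0 := by positivity
  push_cast
  field_simp

/-- The Berezin kernel: a pure element of the poly-hyperball is the compression of the model to a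
co-invariant subspace. -/
theorem exists_berezinKernel [CompleteSpace H] (hm : ∀ i, 1 ≤ m i) {X : OpTuple n H}
    (hX : X ∈ polyHyperball n m H) (hXp : IsPure X) :
    ∃ J : H →ₗᵢ[ℂ] lp (fun _ : Words n => H) 2,
      ∀ i j h, J (star (X i j) h) = star (modelTuple n m H i j) (J h) := by
  -- Any factorization `Δ_X^m(1) = R^* R` serves; the positive square root is not required.
  obtain ⟨R, hR⟩ := CStarAlgebra.nonneg_iff_eq_star_mul_self.1
    ((ContinuousLinearMap.nonneg_iff_isPositive _).2 (hX.2 m le_rfl))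
  have hnull (i) : IsNullSeq fun l => (cpMap (X i) ^ l) (1 : H →L[ℂ] H) := by
    intro h
    have h1 : Tendsto (fun l => RCLike.re (inner ℂ (((cpMap (X i) ^ l) 1) h) h)) atTop
        (𝓝 (RCLike.re (inner ℂ (0 : H) h))) :=
      (RCLike.continuous_re.tendsto _).comp ((hXp i h).inner tendsto_const_nhds)
    simpa [ContinuousLinearMap.reApplyInnerSelf_apply] using h1
  obtain ⟨J, hJ⟩ := exists_linearIsometry_lp
    (fun α : Words n => ((√(wordWeight m α) : ℝ) : ℂ) • (R * star (wordProd X α))) fun h => by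
      have h1 := tsum_wordWeight_quad hX.1 hX.2 hnull h
      have hone : quad (1 : H →L[ℂ] H) h = ENNReal.ofReal (‖h‖ ^ 2) := by
        simp [quad, ContinuousLinearMap.reApplyInnerSelf_apply, inner_self_eq_norm_sq_to_K,
          ← Complex.ofReal_pow]
      rw [← hone, ← h1]
      refine tsum_congr fun α => ?_
      have hq (y : H) : quad (defectMap m X 1) y = ENNReal.ofReal (‖R y‖ ^ 2) := by
        rw [hR, quad, ContinuousLinearMap.reApplyInnerSelf_apply, mul_apply_eq_comp,
          ContinuousLinearMap.star_eq_adjoint, ContinuousLinearMap.adjoint_inner_left]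
        simp [inner_self_eq_norm_sq_to_K, ← Complex.ofReal_pow]
      rw [hq, smul_apply, norm_smul, mul_pow, Complex.norm_real,
        Real.norm_of_nonneg (Real.sqrt_nonneg _), Real.sq_sqrt (by positivity),
        ENNReal.ofReal_mul (by positivity), ENNReal.ofReal_natCast]
      rfl
  refine ⟨J, fun i j h => ?_⟩
  rw [modelTuple, star_forwardShift]
  ext α
  rw [backwardShift_apply, hJ, hJ, smul_apply, smul_apply, smul_smul, ← Complex.ofReal_mul,
    shiftWeight_mul_sqrt_wordWeight hm, wordProd_consWord hX.1, star_mul]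
  rfl

end Berezin

/-! ### Transport along a unitary -/

section Transport

variable {k : ℕ} {n m : Fin k → ℕ}
  {E : Type*} [NormedAddCommGroup E] [InnerProductSpace ℂ E] [CompleteSpace E]
  {H : Type*} [NormedAddCommGroup H] [InnerProductSpace ℂ H] [CompleteSpace H]

theorem defectMap_conj (U : E ≃ₗᵢ[ℂ] H) (p : Fin k → ℕ) (V : OpTuple n E) (T : E →L[ℂ] E) :
    defectMap p (fun i j => U.conjStarAlgEquiv (V i j)) (U.conjStarAlgEquiv T) =
      U.conjStarAlgEquiv (defectMap p V T) := by
  have h1 {d : ℕ} (Z : Fin d → (E →L[ℂ] E)) (T : E →L[ℂ] E) :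
      (1 - cpMap fun j => U.conjStarAlgEquiv (Z j)) (U.conjStarAlgEquiv T) =
        U.conjStarAlgEquiv ((1 - cpMap Z) T) := by
    simp only [LinearMap.sub_apply, Module.End.one_apply, map_sub]
    simp [cpMap, map_sum, map_mul, map_star]
  have h2 {d : ℕ} (Z : Fin d → (E →L[ℂ] E)) (q : ℕ) (T : E →L[ℂ] E) :
      ((1 - cpMap fun j => U.conjStarAlgEquiv (Z j)) ^ q) (U.conjStarAlgEquiv T) =
        U.conjStarAlgEquiv (((1 - cpMap Z) ^ q) T) := by
    induction q with
    | zero => simp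
    | succ q ih => rw [pow_succ', pow_succ', Module.End.mul_apply, Module.End.mul_apply, ih, h1]
  rw [defectMap, defectMap, List.ofFn_eq_map, List.ofFn_eq_map]
  induction List.finRange k with
  | nil => simp
  | cons i L ih =>
    rw [List.map_cons, List.map_cons, List.prod_cons, List.prod_cons, Module.End.mul_apply,
      Module.End.mul_apply, ih, h2]

theorem star_conjStarAlgEquiv (U : E ≃ₗᵢ[ℂ] H) (T : E →L[ℂ] E) :
    star (U.conjStarAlgEquiv T) = U.conjStarAlgEquiv (star T) :=
  (map_star U.conjStarAlgEquiv T).symm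

theorem conj_mem_polyHyperball (U : E ≃ₗᵢ[ℂ] H) {V : OpTuple n E} (hV : V ∈ polyHyperball n m E) :
    (fun i j => U.conjStarAlgEquiv (V i j)) ∈ polyHyperball n m H := by
  refine ⟨fun i j hij a b => (hV.1 i j hij a b).map U.conjStarAlgEquiv, fun p hp => ?_⟩
  have h := hV.2 p hp
  rw [← map_one U.conjStarAlgEquiv, defectMap_conj, ← ContinuousLinearMap.nonneg_iff_isPositive]
  exact map_nonneg U.conjStarAlgEquiv ((ContinuousLinearMap.nonneg_iff_isPositive _).2 h)

theorem IsResolution.conj {ι : Type*} (U : E ≃ₗᵢ[ℂ] H) {Q : ι → (E →L[ℂ] E)}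
    (hQ : IsResolution Q) : IsResolution fun i => U.conjStarAlgEquiv (Q i) := by
  refine ⟨fun i => (hQ.proj i).map U.conjStarAlgEquiv, fun i j hij => ?_, fun x => ?_⟩
  · rw [← map_mul, hQ.orthogonal i j hij, map_zero]
  · simpa using (hQ.hasSum (U.symm x)).mapL (U : E →L[ℂ] H)

end Transport

end PolyHyperball

end

open PolyHyperball in
theorem mainTheorem11 {k : ℕ} (n m : Fin k → ℕ) (hn : ∀ i, 1 ≤ n i) (hm : ∀ i, 1 ≤ m i)
    {K : Type*} [NormedAddCommGroup K] [InnerProductSpace ℂ K] [CompleteSpace K]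
    {H : Type*} [NormedAddCommGroup H] [InnerProductSpace ℂ H] [CompleteSpace H]
    [TopologicalSpace.SeparableSpace H] (hH : ¬ FiniteDimensional ℂ H)
    (F : OpTuple n H → (HilbertTensor K H →L[ℂ] HilbertTensor K H))
    (hF : IsFreePluriharmonic m F) (hFb : IsBoundedOnRadial m F)
    (X : OpTuple n H) (hX : X ∈ polyHyperball n m H) (hXp : IsPure X) :
    ∃ T : HilbertTensor K H →L[ℂ] HilbertTensor K H,
      SOTTendsto (fun r : ℝ => F ((r : ℂ) • X)) (𝓝[<] 1) T := by
  obtain ⟨J, hJ⟩ := exists_berezinKernel hm hX hXp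
  have hwords : Countable (Words n) := by
    have (i : Fin k) : Countable (FreeMonoid (Fin (n i))) :=
      inferInstanceAs (Countable (List (Fin (n i))))
    infer_instance
  have := separableSpace_lp (ι := Words n) (H := H)
  -- `F` accepts only tuples on `H`, so the model is moved there; separability and infinite
  -- dimension of `H` enter at this point.
  obtain ⟨U⟩ := nonempty_linearIsometryEquiv (not_finiteDimensional_lp (ι := Words n) hH) hH
  let J' : H →L[ℂ] H := (U.toLinearIsometry.comp J).toContinuousLinearMap
  refine exists_sotTendsto_of_dilation hF hFb hX
    (conj_mem_polyHyperball U (modelTuple_mem_polyHyperball hm))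
    ((isResolution_gradeProj (wordDegree (n := n))).conj U) (fun i j δ => ?_) (J := J') ?_
    fun i j => ?_
  · rw [← map_mul, ← map_mul, modelTuple_hasDegree m i j δ]
  · exact (ContinuousLinearMap.norm_map_iff_adjoint_comp_self J').1
      (U.toLinearIsometry.comp J).norm_map
  · ext h
    have := congrArg U (hJ i j h)
    rw [star_conjStarAlgEquiv]
    simpa [J'] using this
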